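/- Let $\Bbbk$ be a field, $R=\Bbbk[x_1,\dots,x_n]$ with $\deg x_j=1$, $\mathfrak m=(x_1,\dots,x_n)$, and let $M=\bigoplus_{d\in\mathbb Z}M_d$ be a $\mathbb Z$-graded $R$-module that is bounded below: $M_d=0$ for all $d\ll 0$ (for example, any finitely generated graded module). Let $V$ be a $\Bbbk$-vector space with basis $z_1,\dots,z_n$. The Koszul bicomplex $\mathbb K_{\bullet\bullet}(M)$ is the bicomplex of $R$-modules $$\mathbb K_{pq}(M)=R\otimes_\Bbbk\textstyle\bigwedge^{p+q}V\otimes_\Bbbk M_{-q}$$ with horizontal differential $d_1:f\otimes z^\tau\otimes m\mapsto\sum_{j\in\tau}\pm\,x_jf\otimes z^{\tau\smallsetminus j}\otimes m$ and vertical differential $d:f\otimes z^\tau\otimes m\mapsto\sum_{j\in\tau}\pm\,f\otimes z^{\tau\smallsetminus j}\otimes(-x_jm)$, where $z^\tau$ is the exterior product of the $z_j$ with $j\in\tau$ in increasing order and the signs are $(-1)^{\#\{i\in\tau\,:\,i<j\}}$. Let $d^+$ be any vertical splitting of it: $R$-linear maps $d^+:\mathbb K_{pq}(M)\to\mathbb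 K_{p,q+1}(M)$ with $d^+d^+=0$, $dd^+d=d$ and $d^+dd^+=d^+$. Let $Z_{pq}$ and $B_{pq}$ be the vertical cycles and boundaries in $\mathbb K_{pq}(M)$, put $P=1-dd^+-d^+d$ and $H_{pq}=P(\mathbb K_{pq}(M))$. Consider * (derived Wall complex) $W_{pq}=H_{pq}$ with $\omega_0=0$ and $\omega_j=P(d_1d^+)^{j-1}d_1:W_{pq}\to W_{p-j,q+j-1}$ for $j\ge1$; * (natural Wall complex) $W_{pq}=Z_{pq}/B_{pq}$ with $\omega_0=0$ and $\omega_j:W_{pq}\to W_{p-j,q+j-1}$ induced by $(1-d^+d)(d_1d^+)^{j-1}d_1(1-dd^+)$ for $j\ge1$. In both cases each $w\in W_{pq}$ has only finitely many nonzero images $\omega_j(w)$, and on $W_i=\bigoplus_{p+q=i}W_{pq}$ the map $D=\sum_j\omega_j:W_i\to W_{i-1}$ satisfies $D^2=0$. The total complex $(W_\bullet,D)$ is a minimal free resolution of $M$: $W_i=0$ for $i<0$, every $W_i$ is a free $R$-module, there is an $R$-linear surjection $\varepsilon:W_0\to M$ such that $\cdots\to W_2\to W_1\to W_0\xrightarrow{\varepsilon}M\to0$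 is exact, and $D(W_{i+1})\subseteq\mathfrak m W_i$ for all $i$. If moreover $d^+$ preserves the total degree $\deg(f\otimes z^\tau\otimes m)=\deg f+|\tau|+\deg m$, then, with the grading induced by this degree, this is a graded minimal free resolution: every $W_i$ is a graded free module, and $\varepsilon$ can be chosen so that $D$ and $\varepsilon$ are homogeneous of degree $0$. -/

import Mathlib

open scoped TensorProduct

noncomputable section

namespace WallComplex

/-! ## Internal direct sums -/

section Internal

variable {R : Type*} [Ring R] {ι : Type*} [DecidableEq ι]
  {C : Type*} [AddCommGroup C] [Module R C] {W : Type*} [AddCommGroup W] [Module R W]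

/-- The projection of an internal direct sum to one of its summands. -/
def gradedProj {A : ι → Submodule R C} (h : DirectSum.IsInternal A) (i : ι) : C →ₗ[R] C :=
  (A i).subtype ∘ₗ DirectSum.component R ι (fun i => A i) i ∘ₗ
    (LinearEquiv.ofBijective (DirectSum.coeLinearMap A) h).symm.toLinearMap

lemma gradedProj_of_mem {A : ι → Submodule R C} (h : DirectSum.IsInternal A) {i : ι} {x : C}
    (hx : x ∈ A i) : gradedProj h i x = x := by
  exact congrArg Subtype.val (h.ofBijective_coeLinearMap_of_mem hx)

lemma gradedProj_of_mem_ne {A : ι → Submodule R C} (h : DirectSum.IsInternal A) {i j : ι}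
    (hij : i ≠ j) {x : C} (hx : x ∈ A j) : gradedProj h i x = 0 := by
  exact congrArg Subtype.val (h.ofBijective_coeLinearMap_of_mem_ne hij.symm hx)

lemma isInternal_of_proj {A : ι → Submodule R C} (e : ι → C →ₗ[R] C)
    (h1 : ∀ i, ∀ x ∈ A i, e i x = x) (h2 : ∀ i j, i ≠ j → ∀ x ∈ A j, e i x = 0)
    (h3 : ⨆ i, A i = ⊤) : DirectSum.IsInternal A := by
  refine DirectSum.isInternal_submodule_of_iSupIndep_of_iSup_eq_top ?_ h3
  intro i
  rw [Submodule.disjoint_def]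
  intro x hx hx'
  have : (⨆ j, ⨆ (_ : j ≠ i), A j) ≤ LinearMap.ker (e i) :=
    iSup₂_le fun j hj y hy => h2 i j hj.symm y hy
  rw [← h1 i x hx]
  exact this hx'

lemma isInternal_of_retract {A : ι → Submodule R C} (h : DirectSum.IsInternal A)
    {B : ι → Submodule R W} (φ : C →ₗ[R] W) (ψ : W →ₗ[R] C)
    (hφ : Function.Surjective φ) (hψ : Function.Injective ψ)
    (hφA : ∀ i, ∀ x ∈ A i, φ x ∈ B i) (hψB : ∀ i, ∀ x ∈ B i, ψ x ∈ A i) :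
    DirectSum.IsInternal B := by
  refine DirectSum.isInternal_submodule_of_iSupIndep_of_iSup_eq_top ?_ ?_
  · intro i
    rw [Submodule.disjoint_def]
    intro x hx hx'
    have hle : (⨆ j, ⨆ (_ : j ≠ i), B j) ≤ (⨆ j, ⨆ (_ : j ≠ i), A j).comap ψ :=
      iSup₂_le fun j hj y hy =>
        (le_iSup₂ (f := fun j (_ : j ≠ i) => A j) j hj) (hψB j y hy)
    have := Submodule.disjoint_def.1 (h.submodule_iSupIndep i) _ (hψB i x hx) (hle hx')
    exact hψ (by rw [this, map_zero])
  · rw [eq_top_iff]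
    intro x _
    obtain ⟨y, rfl⟩ := hφ x
    have hle : (⨆ i, A i) ≤ (⨆ i, B i).comap φ :=
      iSup_le fun i z hz => (le_iSup B i) (hφA i z hz)
    exact hle (h.submodule_iSup_eq_top ▸ Submodule.mem_top)

end Internal

/-! ## Wall complexes -/

/-- A doubly indexed array `W_{pq}` of `R`-modules with maps
`ω_j : W_{pq} → W_{p-j,q+j-1}` for `j ∈ ℕ`.  The array is given as the module
`W = ⨁ W_{pq}` together with its summands `deg p q = W_{pq}`, and each `ω_j` is given as one
endomorphism of `W` that respects the indices. -/
structure WallArray (R : Type*) [Ring R] (W : Type*) [AddCommGroup W] [Module R W] where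
  deg : ℤ → ℤ → Submodule R W
  isInternal : DirectSum.IsInternal fun a : ℤ × ℤ => deg a.1 a.2
  ω : ℕ → W →ₗ[R] W
  ω_mem : ∀ (j : ℕ) (p q : ℤ) (x : W), x ∈ deg p q → ω j x ∈ deg (p - j) (q + j - 1)

namespace WallArray

variable {R : Type*} [Ring R] {W : Type*} [AddCommGroup W] [Module R W] (A : WallArray R W)

/-- Each element of each `W_{pq}` has only finitely many nonzero images `ω_j(w)`. -/
def LocallyFinite : Prop :=
  ∀ (p q : ℤ) (w : W), w ∈ A.deg p q → {j : ℕ | A.ω j w ≠ 0}.Finite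

lemma induction_deg {motive : W → Prop} (w : W)
    (mem : ∀ p q w, w ∈ A.deg p q → motive w) (zero : motive 0)
    (add : ∀ x y, motive x → motive y → motive (x + y)) : motive w := by
  have hw : w ∈ ⨆ a : ℤ × ℤ, A.deg a.1 a.2 :=
    A.isInternal.submodule_iSup_eq_top ▸ Submodule.mem_top
  exact Submodule.iSup_induction _ (motive := motive) hw (fun a x hx => mem a.1 a.2 x hx) zero add

variable {A} in
lemma LocallyFinite.finite (h : A.LocallyFinite) (w : W) :
    (Function.support fun j : ℕ => A.ω j w).Finite := by
  refine A.induction_deg w (fun p q w hw => h p q w hw) ?_ ?_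
  · simp
  · intro x y hx hy
    refine (hx.union hy).subset ?_
    simp only [map_add]
    exact Function.support_add _ _

/-- The differential `D = ∑_{j ≥ 0} ω_j`. -/
def D (h : A.LocallyFinite) : W →ₗ[R] W where
  toFun w := ∑ᶠ j : ℕ, A.ω j w
  map_add' x y := by
    simp only [map_add]
    exact finsum_add_distrib (h.finite x) (h.finite y)
  map_smul' r x := by
    simp only [map_smul, RingHom.id_apply]
    exact (smul_finsum' r (h.finite x)).symm

/-- The summand `W_i = ⨁_{p+q=i} W_{pq}` of the total complex. -/
def total (i : ℤ) : Submodule R W := ⨆ p : ℤ, A.deg p (i - p)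

lemma D_mem (h : A.LocallyFinite) (i : ℤ) (w : W) (hw : w ∈ A.total (i + 1)) :
    A.D h w ∈ A.total i := by
  have hle : A.total (i + 1) ≤ (A.total i).comap (A.D h) := by
    refine iSup_le fun p x hx => ?_
    change ∑ᶠ j : ℕ, A.ω j x ∈ A.total i
    refine finsum_induction (· ∈ A.total i) (Submodule.zero_mem _)
      (fun _ _ => Submodule.add_mem _) fun j => ?_
    have := A.ω_mem j p (i + 1 - p) x hx
    have e : i + 1 - p + j - 1 = i - (p - j) := by ring
    rw [e] at this
    exact le_iSup (fun p => A.deg p (i - p)) (p - j) this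
  exact hle hw

/-- The differential `D_{i+1} : W_{i+1} → W_i` of the total complex. -/
def totalDiff (h : A.LocallyFinite) (i : ℤ) : A.total (i + 1) →ₗ[R] A.total i :=
  (A.D h).restrict (A.D_mem h i)

/-- The array is a Wall complex: it is locally finite and `D² = 0`. -/
structure IsWallComplex : Prop where
  locallyFinite : A.LocallyFinite
  D_sq : A.D locallyFinite ∘ₗ A.D locallyFinite = 0

end WallArray

/-! ## Bicomplexes and vertical splittings -/

/-- A bicomplex of `R`-modules, given as the module `C = ⨁ C_{pq}` together with its summands
`deg p q = C_{pq}`, the vertical differential `d : C_{pq} → C_{p,q-1}` and the horizontal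
differential `d₁ : C_{pq} → C_{p-1,q}`; these anticommute, so that `d + d₁` is a differential. -/
structure Bicomplex (R : Type*) [Ring R] (C : Type*) [AddCommGroup C] [Module R C] where
  deg : ℤ → ℤ → Submodule R C
  isInternal : DirectSum.IsInternal fun a : ℤ × ℤ => deg a.1 a.2
  d : C →ₗ[R] C
  d₁ : C →ₗ[R] C
  d_mem : ∀ (p q : ℤ) (x : C), x ∈ deg p q → d x ∈ deg p (q - 1)
  d₁_mem : ∀ (p q : ℤ) (x : C), x ∈ deg p q → d₁ x ∈ deg (p - 1) q
  d_d : d ∘ₗ d = 0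
  d₁_d₁ : d₁ ∘ₗ d₁ = 0
  d_d₁ : d ∘ₗ d₁ + d₁ ∘ₗ d = 0

/-- A vertical splitting `d⁺ : C_{pq} → C_{p,q+1}` of a bicomplex:
`d⁺ d⁺ = 0`, `d d⁺ d = d` and `d⁺ d d⁺ = d⁺`. -/
structure VerticalSplitting {R : Type*} [Ring R] {C : Type*} [AddCommGroup C] [Module R C]
    (B : Bicomplex R C) where
  dplus : C →ₗ[R] C
  dplus_mem : ∀ (p q : ℤ) (x : C), x ∈ B.deg p q → dplus x ∈ B.deg p (q + 1)
  dplus_dplus : dplus ∘ₗ dplus = 0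
  d_dplus_d : B.d ∘ₗ dplus ∘ₗ B.d = B.d
  dplus_d_dplus : dplus ∘ₗ B.d ∘ₗ dplus = dplus

namespace VerticalSplitting

variable {R : Type*} [Ring R] {C : Type*} [AddCommGroup C] [Module R C]
  {B : Bicomplex R C} (S : VerticalSplitting B)

lemma dd (x : C) : B.d (B.d x) = 0 := LinearMap.congr_fun B.d_d x
lemma ss (x : C) : S.dplus (S.dplus x) = 0 := LinearMap.congr_fun S.dplus_dplus x
lemma dsd (x : C) : B.d (S.dplus (B.d x)) = B.d x := LinearMap.congr_fun S.d_dplus_d x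
lemma sds (x : C) : S.dplus (B.d (S.dplus x)) = S.dplus x :=
  LinearMap.congr_fun S.dplus_d_dplus x

lemma ds_mem {p q : ℤ} {x : C} (hx : x ∈ B.deg p q) : B.d (S.dplus x) ∈ B.deg p q := by
  simpa using B.d_mem _ _ _ (S.dplus_mem _ _ _ hx)

lemma sd_mem {p q : ℤ} {x : C} (hx : x ∈ B.deg p q) : S.dplus (B.d x) ∈ B.deg p q := by
  simpa using S.dplus_mem _ _ _ (B.d_mem _ _ _ hx)

/-- The homology projection `P = 1 - d d⁺ - d⁺ d`. -/
def P : C →ₗ[R] C := LinearMap.id - B.d ∘ₗ S.dplus - S.dplus ∘ₗ B.d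

lemma P_apply (x : C) : S.P x = x - B.d (S.dplus x) - S.dplus (B.d x) := rfl

lemma P_mem {p q : ℤ} {x : C} (hx : x ∈ B.deg p q) : S.P x ∈ B.deg p q :=
  Submodule.sub_mem _ (Submodule.sub_mem _ hx (S.ds_mem hx)) (S.sd_mem hx)

/-- `(d₁ d⁺)^j d₁`, a map `C_{pq} → C_{p-j-1,q+j}`. -/
def zigzag (j : ℕ) : C →ₗ[R] C := ((B.d₁ ∘ₗ S.dplus) ^ j) ∘ₗ B.d₁

lemma zigzag_mem (j : ℕ) {p q : ℤ} {x : C} (hx : x ∈ B.deg p q) :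
    S.zigzag j x ∈ B.deg (p - (j + 1 : ℕ)) (q + (j + 1 : ℕ) - 1) := by
  induction j with
  | zero => simpa [zigzag] using B.d₁_mem _ _ _ hx
  | succ j ih =>
    have h1 := B.d₁_mem _ _ _ (S.dplus_mem _ _ _ ih)
    have e : S.zigzag (j + 1) x = B.d₁ (S.dplus (S.zigzag j x)) := by
      simp [zigzag, pow_succ']
    rw [e]
    convert h1 using 2 <;> push_cast <;> ring

/-- The split homology `H = ⨁ H_{pq}`, a submodule of `C = ⨁ C_{pq}`. -/
abbrev splitHomology : Submodule R C := LinearMap.range S.P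

/-- The derived Wall complex: the split homology `H_{pq} ⊆ C_{pq}` with `ω_0 = 0` and
`ω_j = P (d₁ d⁺)^{j-1} d₁` for `j ≥ 1`. -/
def derivedWall : WallArray R S.splitHomology where
  deg p q := (B.deg p q).comap S.splitHomology.subtype
  isInternal := isInternal_of_retract B.isInternal S.P.rangeRestrict S.splitHomology.subtype
    S.P.surjective_rangeRestrict (Submodule.injective_subtype _)
    (fun _ _ hx => S.P_mem hx) (fun _ _ hx => hx)
  ω
    | 0 => 0
    | j + 1 => S.P.rangeRestrict ∘ₗ S.zigzag j ∘ₗ S.splitHomology.subtype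
  ω_mem
    | 0, _, _, _, _ => Submodule.zero_mem _
    | j + 1, _, _, _, hx => S.P_mem (S.zigzag_mem j hx)

/-- The projection `1 - d⁺ d` from chains to cycles. -/
def toCycles : C →ₗ[R] LinearMap.ker B.d :=
  (LinearMap.id - S.dplus ∘ₗ B.d).codRestrict _ fun x => by simp [S.dsd]

lemma coe_toCycles (x : C) : (S.toCycles x : C) = x - S.dplus (B.d x) := rfl

end VerticalSplitting

section Natural

variable {R : Type*} [Ring R] {C : Type*} [AddCommGroup C] [Module R C]

/-- The vertical boundaries `⨁ B_{pq}` inside the vertical cycles `⨁ Z_{pq}`. -/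
abbrev Bicomplex.boundaries (B : Bicomplex R C) : Submodule R (LinearMap.ker B.d) :=
  (LinearMap.range B.d).comap (LinearMap.ker B.d).subtype

/-- The natural vertical homology `⨁ Z_{pq} / B_{pq}`. -/
abbrev Bicomplex.naturalHomology (B : Bicomplex R C) : Type _ :=
  LinearMap.ker B.d ⧸ B.boundaries

end Natural

namespace VerticalSplitting

variable {R : Type*} [Ring R] {C : Type*} [AddCommGroup C] [Module R C]
  {B : Bicomplex R C} (S : VerticalSplitting B)

/-- The map `(1 - d⁺ d) (d₁ d⁺)^j d₁ (1 - d d⁺)` on vertical cycles. -/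
def naturalOmegaCycles (j : ℕ) : LinearMap.ker B.d →ₗ[R] LinearMap.ker B.d :=
  S.toCycles ∘ₗ S.zigzag j ∘ₗ (LinearMap.id - B.d ∘ₗ S.dplus) ∘ₗ (LinearMap.ker B.d).subtype

lemma naturalOmegaCycles_boundaries (j : ℕ) :
    B.boundaries ≤ B.boundaries.comap (S.naturalOmegaCycles j) := by
  rintro ⟨_, hx⟩ ⟨y, rfl⟩
  have : S.naturalOmegaCycles j ⟨B.d y, hx⟩ = 0 := by
    simp [naturalOmegaCycles, S.dsd]
  rw [Submodule.mem_comap, this]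
  exact Submodule.zero_mem _

lemma naturalHomology_isInternal (S : VerticalSplitting B) :
    DirectSum.IsInternal fun a : ℤ × ℤ =>
      ((B.deg a.1 a.2).comap (LinearMap.ker B.d).subtype).map B.boundaries.mkQ := by
  let ψ : B.naturalHomology →ₗ[R] C :=
    B.boundaries.liftQ ((LinearMap.id - B.d ∘ₗ S.dplus) ∘ₗ (LinearMap.ker B.d).subtype) (by
      rintro ⟨_, hx⟩ ⟨y, rfl⟩
      simp [S.dsd])
  refine isInternal_of_retract B.isInternal (B.boundaries.mkQ ∘ₗ S.toCycles) ψ ?_ ?_ ?_ ?_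
  · intro z
    obtain ⟨⟨x, hx⟩, rfl⟩ := B.boundaries.mkQ_surjective z
    refine ⟨x, ?_⟩
    have : S.toCycles x = ⟨x, hx⟩ := by
      apply Subtype.ext
      rw [coe_toCycles, LinearMap.mem_ker.1 hx, map_zero, sub_zero]
    simp [this]
  · rw [← LinearMap.ker_eq_bot, LinearMap.ker_eq_bot']
    intro z hz
    obtain ⟨⟨x, hx⟩, rfl⟩ := B.boundaries.mkQ_surjective z
    have hz' : x - B.d (S.dplus x) = 0 := hz
    rw [Submodule.mkQ_apply, Submodule.Quotient.mk_eq_zero]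
    exact ⟨S.dplus x, (sub_eq_zero.1 hz').symm⟩
  · rintro ⟨p, q⟩ x hx
    exact ⟨S.toCycles x, Submodule.sub_mem _ hx (S.sd_mem hx), rfl⟩
  · rintro ⟨p, q⟩ _ ⟨x, hx, rfl⟩
    exact Submodule.sub_mem _ hx (S.ds_mem hx)

/-- The natural Wall complex: the natural homology `Z_{pq} / B_{pq}` with `ω_0 = 0` and, for
`j ≥ 1`, the map `ω_j` induced by `(1 - d⁺ d) (d₁ d⁺)^{j-1} d₁ (1 - d d⁺)` on cycles. -/
def naturalWall : WallArray R B.naturalHomology where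
  deg p q := ((B.deg p q).comap (LinearMap.ker B.d).subtype).map B.boundaries.mkQ
  isInternal := S.naturalHomology_isInternal
  ω
    | 0 => 0
    | j + 1 => B.boundaries.mapQ B.boundaries (S.naturalOmegaCycles j)
        (S.naturalOmegaCycles_boundaries j)
  ω_mem
    | 0, _, _, _, _ => Submodule.zero_mem _
    | j + 1, p, q, _, hx => by
      obtain ⟨z, hz, rfl⟩ := hx
      refine ⟨S.naturalOmegaCycles j z, ?_, rfl⟩
      have h1 : (z : C) - B.d (S.dplus z) ∈ B.deg p q := Submodule.sub_mem _ hz (S.ds_mem hz)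
      have h2 := S.zigzag_mem j h1
      exact Submodule.sub_mem _ h2 (S.sd_mem h2)

/-- If `E` is a subgroup of `C`, for example the elements of a given degree, this is the
corresponding subgroup of the `i`-th module of the derived Wall total complex. -/
def derivedPart (E : AddSubgroup C) (i : ℤ) : AddSubgroup (S.derivedWall.total i) :=
  E.comap ((S.splitHomology.subtype ∘ₗ (S.derivedWall.total i).subtype : _ →ₗ[R] C) : _ →+ C)

/-- If `E` is a subgroup of `C`, for example the elements of a given degree, this is the
subgroup of the `i`-th module of the natural Wall total complex that consists of the classes of
the vertical cycles in `E`. -/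
def naturalPart (E : AddSubgroup C) (i : ℤ) : AddSubgroup (S.naturalWall.total i) :=
  ((E.comap ((LinearMap.ker B.d).subtype : _ →+ C)).map
    (B.boundaries.mkQ : LinearMap.ker B.d →+ B.naturalHomology)).comap
      ((S.naturalWall.total i).subtype : _ →+ B.naturalHomology)

end VerticalSplitting

/-! ## Koszul bicomplexes -/

section KoszulMap

variable {R : Type*} [CommRing R] {N : Type*} [AddCommGroup N] [Module R N] {n : ℕ}

/-- The sign of the face `σ` in the boundary of `σ ∪ {j}`, for `j ∉ σ`. -/
def koszulSign (j : Fin n) (σ : Finset (Fin n)) : ℤ := (-1) ^ (σ.filter (· < j)).card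

/-- An element of `⋀ V ⊗ N`, where `V` has basis `z_1, …, z_n`, is written as the family of its
coefficients in `N` with respect to the basis `z^σ`, `σ ⊆ {1, …, n}`, of `⋀ V`.  In these
terms, `koszulMap T` is the Koszul differential
`z^τ ⊗ m ↦ ∑_{j ∈ τ} ± z^{τ ∖ j} ⊗ T_j m` for operators `T_1, …, T_n` on `N`. -/
def koszulMap (T : Fin n → N →ₗ[R] N) : (Finset (Fin n) → N) →ₗ[R] (Finset (Fin n) → N) :=
  LinearMap.pi fun σ => ∑ j ∈ σᶜ, koszulSign j σ • (T j ∘ₗ LinearMap.proj (insert j σ))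

lemma koszulMap_apply (T : Fin n → N →ₗ[R] N) (c : Finset (Fin n) → N) (σ : Finset (Fin n)) :
    koszulMap T c σ = ∑ j ∈ σᶜ, koszulSign j σ • T j (c (insert j σ)) := by
  simp [koszulMap]

lemma koszulMap_single (T : Fin n → N →ₗ[R] N) (τ : Finset (Fin n)) (m : N) :
    koszulMap T (Pi.single τ m) =
      ∑ j ∈ τ, koszulSign j (τ.erase j) • Pi.single (τ.erase j) (T j m) := by
  ext σ
  rw [koszulMap_apply, Finset.sum_apply]
  have hl : ∀ j ∈ σᶜ, koszulSign j σ • T j ((Pi.single τ m : Finset (Fin n) → N) (insert j σ)) =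
      if insert j σ = τ then koszulSign j σ • T j m else 0 := by
    intro j _
    rw [Pi.single_apply]
    split_ifs <;> simp
  have hr : ∀ j ∈ τ, (koszulSign j (τ.erase j) •
      (Pi.single (τ.erase j) (T j m) : Finset (Fin n) → N)) σ =
      if σ = τ.erase j then koszulSign j σ • T j m else 0 := by
    intro j _
    rw [Pi.smul_apply, Pi.single_apply]
    split_ifs with h
    · rw [h]
    · simp
  rw [Finset.sum_congr rfl hl, Finset.sum_congr rfl hr, ← Finset.sum_filter, ← Finset.sum_filter]
  refine Finset.sum_congr ?_ fun _ _ => rfl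
  ext j
  simp only [Finset.mem_filter, Finset.mem_compl]
  constructor
  · rintro ⟨hj, rfl⟩
    exact ⟨Finset.mem_insert_self _ _, (Finset.erase_insert hj).symm⟩
  · rintro ⟨hj, rfl⟩
    exact ⟨Finset.notMem_erase _ _, Finset.insert_erase hj⟩

lemma koszulSign_insert {j l : Fin n} {σ : Finset (Fin n)} (hj : j ∉ σ) (hl : l ∉ σ)
    (hjl : j ≠ l) : koszulSign j σ * koszulSign l (insert j σ) =
      -(koszulSign l σ * koszulSign j (insert l σ)) := by
  unfold koszulSign
  rcases lt_or_gt_of_ne hjl with h | h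
  · rw [Finset.filter_insert, if_pos h, Finset.filter_insert, if_neg (not_lt.2 h.le),
      Finset.card_insert_of_notMem (by simp [hj])]
    ring
  · rw [Finset.filter_insert, if_neg (not_lt.2 h.le), Finset.filter_insert, if_pos h,
      Finset.card_insert_of_notMem (by simp [hl])]
    ring

lemma koszulMap_koszulMap (T : Fin n → N →ₗ[R] N)
    (hT : ∀ j l, T j ∘ₗ T l = T l ∘ₗ T j) : koszulMap T ∘ₗ koszulMap T = 0 := by
  refine LinearMap.ext fun c => funext fun σ => ?_
  simp only [LinearMap.comp_apply, koszulMap_apply, LinearMap.zero_apply, Pi.zero_apply, map_sum,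
    map_zsmul, Finset.smul_sum, smul_smul]
  rw [Finset.sum_sigma']
  refine Finset.sum_involution (fun a _ => ⟨a.2, a.1⟩) ?_ ?_ ?_ ?_
  · rintro ⟨j, l⟩ h
    simp only [Finset.mem_sigma, Finset.mem_compl, Finset.mem_insert, not_or] at h
    have hc : T j (T l (c (insert l (insert j σ)))) = T l (T j (c (insert j (insert l σ)))) := by
      rw [Finset.insert_comm l j σ]
      exact LinearMap.congr_fun (hT j l) _
    simp only [hc]
    rw [koszulSign_insert h.1 h.2.2 (Ne.symm h.2.1), neg_smul, neg_add_cancel]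
  · rintro ⟨j, l⟩ h _ he
    simp only [Finset.mem_sigma, Finset.mem_compl, Finset.mem_insert, not_or] at h
    simp only [Sigma.mk.injEq] at he
    exact h.2.1 he.1
  · rintro ⟨j, l⟩ h
    simp only [Finset.mem_sigma, Finset.mem_compl, Finset.mem_insert, not_or] at h ⊢
    exact ⟨h.2.2, fun e => h.2.1 e.symm, h.1⟩
  · rintro ⟨j, l⟩ _
    rfl

lemma koszulMap_add (T T' : Fin n → N →ₗ[R] N) :
    koszulMap (fun j => T j + T' j) = koszulMap T + koszulMap T' := by
  refine LinearMap.ext fun c => funext fun σ => ?_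
  simp [koszulMap_apply, Finset.sum_add_distrib]

lemma koszulMap_anticomm (T T' : Fin n → N →ₗ[R] N)
    (hT : ∀ j l, T j ∘ₗ T l = T l ∘ₗ T j) (hT' : ∀ j l, T' j ∘ₗ T' l = T' l ∘ₗ T' j)
    (hTT' : ∀ j l, T j ∘ₗ T' l = T' l ∘ₗ T j) :
    koszulMap T ∘ₗ koszulMap T' + koszulMap T' ∘ₗ koszulMap T = 0 := by
  have h := koszulMap_koszulMap (fun j => T j + T' j) fun j l => by
    simp only [LinearMap.add_comp, LinearMap.comp_add, hT j l, hT' j l, hTT' j l, ← hTT' l j]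
    abel
  rw [koszulMap_add, LinearMap.add_comp, LinearMap.comp_add, LinearMap.comp_add,
    koszulMap_koszulMap T hT, koszulMap_koszulMap T' hT'] at h
  simpa using h

end KoszulMap

section Koszul

variable {k : Type*} [Field k] {n : ℕ} {M : Type*} [AddCommGroup M] [Module k M]

/-- The family `(M_d)` is a `ℤ`-grading of the `k[x_1, …, x_n]`-module `M`, where
each variable has degree `1`. -/
structure IsStandardGrading (n : ℕ) {k : Type*} [Field k] {M : Type*} [AddCommGroup M] [Module k M]
    [Module (MvPolynomial (Fin n) k) M] (ℳ : ℤ → Submodule k M) : Prop where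
  isInternal : DirectSum.IsInternal ℳ
  X_smul_mem : ∀ (j : Fin n) (d : ℤ) (m : M), m ∈ ℳ d →
    (MvPolynomial.X j : MvPolynomial (Fin n) k) • m ∈ ℳ (d + 1)

/-- The module `⋀ V ⊗ k[x] ⊗ M` underlying the Koszul bicomplex of `M`; an element is written as
the family of its coefficients in `k[x] ⊗ M` with respect to the basis `z^σ` of `⋀ V`. -/
abbrev KoszulModule (n : ℕ) (k : Type*) [Field k] (M : Type*) [AddCommGroup M] [Module k M] :
    Type _ :=
  Finset (Fin n) → MvPolynomial (Fin n) k ⊗[k] M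

/-- The action of `x_j` on the left factor of `k[x] ⊗ M`. -/
def xAct (n : ℕ) (k : Type*) [Field k] (M : Type*) [AddCommGroup M] [Module k M] (j : Fin n) :
    MvPolynomial (Fin n) k ⊗[k] M →ₗ[MvPolynomial (Fin n) k] MvPolynomial (Fin n) k ⊗[k] M :=
  LinearMap.lsmul _ _ (MvPolynomial.X j)

@[simp] lemma xAct_tmul (j : Fin n) (f : MvPolynomial (Fin n) k) (m : M) :
    xAct n k M j (f ⊗ₜ m) = (MvPolynomial.X j * f) ⊗ₜ m := rfl

lemma xAct_comm (j l : Fin n) :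
    xAct n k M j ∘ₗ xAct n k M l = xAct n k M l ∘ₗ xAct n k M j := by
  ext; simp [xAct, smul_smul, mul_comm]

/-- The summand `K_{pq}(M) = ⋀^{p+q} V ⊗ k[x] ⊗ M_{-q}` of `⋀ V ⊗ k[x] ⊗ M`. -/
def koszulPiece (n : ℕ) {k : Type*} [Field k] {M : Type*} [AddCommGroup M] [Module k M]
    (ℳ : ℤ → Submodule k M) (p q : ℤ) :
    Submodule (MvPolynomial (Fin n) k) (KoszulModule n k M) :=
  Submodule.pi Set.univ fun σ =>
    if (σ.card : ℤ) = p + q then (ℳ (-q)).baseChange (MvPolynomial (Fin n) k) else ⊥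

lemma mem_koszulPiece {ℳ : ℤ → Submodule k M} {p q : ℤ} {c : KoszulModule n k M} :
    c ∈ koszulPiece n ℳ p q ↔
      (∀ σ, (σ.card : ℤ) = p + q → c σ ∈ (ℳ (-q)).baseChange (MvPolynomial (Fin n) k)) ∧
      ∀ σ, (σ.card : ℤ) ≠ p + q → c σ = 0 := by
  simp only [koszulPiece, Submodule.mem_pi, Set.mem_univ, true_imp_iff]
  constructor
  · intro h
    exact ⟨fun σ hσ => by simpa [hσ] using h σ, fun σ hσ => by simpa [hσ] using h σ⟩
  · rintro ⟨h1, h2⟩ σ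
    split_ifs with h
    · exact h1 σ h
    · exact h2 σ h

lemma koszulPiece_isInternal {ℳ : ℤ → Submodule k M} (h : DirectSum.IsInternal ℳ) :
    DirectSum.IsInternal fun a : ℤ × ℤ => koszulPiece n ℳ a.1 a.2 := by
  have key1 : ∀ d, ∀ x ∈ (ℳ d).baseChange (MvPolynomial (Fin n) k),
      (gradedProj h d).baseChange (MvPolynomial (Fin n) k) x = x := by
    rintro d _ ⟨y, rfl⟩
    induction y with
    | zero => simp
    | add a b ha hb => simp only [map_add, ha, hb]
    | tmul f m => simp [gradedProj_of_mem h m.2]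
  have key2 : ∀ d e, d ≠ e → ∀ x ∈ (ℳ e).baseChange (MvPolynomial (Fin n) k),
      (gradedProj h d).baseChange (MvPolynomial (Fin n) k) x = 0 := by
    rintro d e hde _ ⟨y, rfl⟩
    induction y with
    | zero => simp
    | add a b ha hb => simp only [map_add, ha, hb, add_zero]
    | tmul f m => simp [gradedProj_of_mem_ne h hde m.2]
  refine isInternal_of_proj (fun a => LinearMap.pi fun σ =>
    if (σ.card : ℤ) = a.1 + a.2 then
      (gradedProj h (-a.2)).baseChange (MvPolynomial (Fin n) k) ∘ₗ LinearMap.proj σ else 0) ?_ ?_ ?_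
  · rintro ⟨p, q⟩ c hc
    obtain ⟨h1, h2⟩ := mem_koszulPiece.1 hc
    funext σ
    simp only [LinearMap.pi_apply]
    split_ifs with hσ
    · exact key1 _ _ (h1 σ hσ)
    · exact (h2 σ hσ).symm
  · rintro ⟨p, q⟩ ⟨p', q'⟩ hne c hc
    obtain ⟨h1, h2⟩ := mem_koszulPiece.1 hc
    funext σ
    simp only [LinearMap.pi_apply]
    split_ifs with hσ
    · by_cases hσ' : (σ.card : ℤ) = p' + q'
      · refine key2 _ _ ?_ _ (h1 σ hσ')
        rintro e
        simp only at hσ e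
        exact hne (Prod.ext (by simp only; omega) (by simp only; omega))
      · simp [h2 σ hσ']
    · rfl
  · rw [eq_top_iff]
    intro c _
    rw [← Finset.univ_sum_single c]
    refine Submodule.sum_mem _ fun σ _ => ?_
    generalize c σ = x
    induction x with
    | zero => simp
    | add a b ha hb => rw [Pi.single_add]; exact Submodule.add_mem _ ha hb
    | tmul f m =>
      have hm : m ∈ ⨆ d, ℳ d := h.submodule_iSup_eq_top ▸ Submodule.mem_top
      induction hm using Submodule.iSup_induction' with
      | zero => simp
      | add a b _ _ ha hb =>
        rw [TensorProduct.tmul_add, Pi.single_add]; exact Submodule.add_mem _ ha hb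
      | mem d m hm =>
        refine le_iSup (fun a : ℤ × ℤ => koszulPiece n ℳ a.1 a.2) ((σ.card : ℤ) + d, -d) ?_
        refine mem_koszulPiece.2 ⟨fun τ _ => ?_, fun τ hτ => ?_⟩
        · by_cases e : τ = σ
          · subst e
            simpa using Submodule.tmul_mem_baseChange_of_mem f hm
          · simp [Pi.single_eq_of_ne e]
        · refine Pi.single_eq_of_ne ?_ _
          rintro rfl
          simp at hτ

lemma koszulMap_mem {ℳ : ℤ → Submodule k M} {p q p' q' : ℤ} (hpq : p' + q' = p + q - 1)
    (T : Fin n → MvPolynomial (Fin n) k ⊗[k] M →ₗ[MvPolynomial (Fin n) k]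
      MvPolynomial (Fin n) k ⊗[k] M)
    (hT : ∀ j, ∀ x ∈ (ℳ (-q)).baseChange (MvPolynomial (Fin n) k),
      T j x ∈ (ℳ (-q')).baseChange (MvPolynomial (Fin n) k))
    {c : KoszulModule n k M} (hc : c ∈ koszulPiece n ℳ p q) :
    koszulMap T c ∈ koszulPiece n ℳ p' q' := by
  obtain ⟨h1, h2⟩ := mem_koszulPiece.1 hc
  refine mem_koszulPiece.2 ⟨fun σ hσ => ?_, fun σ hσ => ?_⟩
  · rw [koszulMap_apply]
    refine Submodule.sum_mem _ fun j hj => zsmul_mem (hT j _ (h1 _ ?_)) _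
    rw [Finset.card_insert_of_notMem (Finset.mem_compl.1 hj)]
    push_cast
    omega
  · rw [koszulMap_apply]
    refine Finset.sum_eq_zero fun j hj => ?_
    rw [h2, map_zero, smul_zero]
    rw [Finset.card_insert_of_notMem (Finset.mem_compl.1 hj)]
    push_cast
    omega

variable [Module (MvPolynomial (Fin n) k) M] [IsScalarTower k (MvPolynomial (Fin n) k) M]

/-- The action of `y_j` on `k[x] ⊗ M^{-y}`: it acts on the right factor as `-x_j`. -/
def yAct (n : ℕ) (k : Type*) [Field k] (M : Type*) [AddCommGroup M] [Module k M]
    [Module (MvPolynomial (Fin n) k) M] [IsScalarTower k (MvPolynomial (Fin n) k) M] (j : Fin n) :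
    MvPolynomial (Fin n) k ⊗[k] M →ₗ[MvPolynomial (Fin n) k] MvPolynomial (Fin n) k ⊗[k] M :=
  (-(Algebra.lsmul k k M (MvPolynomial.X j : MvPolynomial (Fin n) k))).baseChange _

@[simp] lemma yAct_tmul (j : Fin n) (f : MvPolynomial (Fin n) k) (m : M) :
    yAct n k M j (f ⊗ₜ m) =
      f ⊗ₜ (-((MvPolynomial.X j : MvPolynomial (Fin n) k) • m)) := rfl

lemma yAct_comm (j l : Fin n) :
    yAct n k M j ∘ₗ yAct n k M l = yAct n k M l ∘ₗ yAct n k M j := by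
  ext; simp [smul_smul, mul_comm]

lemma yAct_xAct (j l : Fin n) :
    yAct n k M j ∘ₗ xAct n k M l = xAct n k M l ∘ₗ yAct n k M j := by
  ext; simp

/-- The Koszul bicomplex of the graded module `M`, with
`K_{pq}(M) = ⋀^{p+q} V ⊗ k[x] ⊗ M_{-q}`, horizontal differential
`z^τ ⊗ f ⊗ m ↦ ∑ ± z^{τ ∖ j} ⊗ x_j f ⊗ m` and vertical differential
`z^τ ⊗ f ⊗ m ↦ ∑ ± z^{τ ∖ j} ⊗ f ⊗ y_j m`, where `y_j` acts on `M` as `-x_j`. -/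
def koszulBicomplex (ℳ : ℤ → Submodule k M) (hℳ : IsStandardGrading n ℳ) :
    Bicomplex (MvPolynomial (Fin n) k) (KoszulModule n k M) where
  deg := koszulPiece n ℳ
  isInternal := koszulPiece_isInternal hℳ.isInternal
  d := koszulMap (yAct n k M)
  d₁ := koszulMap (xAct n k M)
  d_mem p q c hc := by
    refine koszulMap_mem (by ring) _ (fun j x hx => ?_) hc
    obtain ⟨y, rfl⟩ := hx
    induction y with
    | zero => simp
    | add a b ha hb => simp only [map_add]; exact Submodule.add_mem _ ha hb
    | tmul f m =>
      have h := hℳ.X_smul_mem j _ _ m.2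
      rw [show -q + 1 = -(q - 1) by ring] at h
      exact Submodule.tmul_mem_baseChange_of_mem f (Submodule.neg_mem _ h)
  d₁_mem p q c hc :=
    koszulMap_mem (by ring) (xAct n k M) (fun _ _ hx => Submodule.smul_mem _ _ hx) hc
  d_d := koszulMap_koszulMap _ yAct_comm
  d₁_d₁ := koszulMap_koszulMap _ xAct_comm
  d_d₁ := koszulMap_anticomm _ _ yAct_comm xAct_comm yAct_xAct

/-- The component of degree `t` of `⋀ V ⊗ k[x] ⊗ M`, where `z^σ ⊗ f ⊗ m` has degree
`|σ| + deg f + deg m`. -/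
def koszulDegree (n : ℕ) {k : Type*} [Field k] {M : Type*} [AddCommGroup M] [Module k M]
    (ℳ : ℤ → Submodule k M) (t : ℤ) : AddSubgroup (KoszulModule n k M) :=
  AddSubgroup.closure {c | ∃ (σ : Finset (Fin n)) (a : ℕ) (e : ℤ) (f : MvPolynomial (Fin n) k)
    (m : M), f.IsHomogeneous a ∧ m ∈ ℳ e ∧ (σ.card : ℤ) + a + e = t ∧ c = Pi.single σ (f ⊗ₜ m)}

end Koszul

/-! ## Minimal free resolutions -/

section Resolution

variable {k : Type*} [Field k] {n : ℕ}

/-- The complex `⋯ → F_1 → F_0 → 0` (with differentials `∂ i : F_{i+1} → F_i`) and the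
augmentation `ε : F_0 → M` form a minimal free resolution of the `k[x]`-module `M`; minimality
means that the image of each differential lies in `(x_1, …, x_n) F_i`. -/
structure IsMinimalFreeResolution {F : ℤ → Type*} [∀ i, AddCommGroup (F i)]
    [∀ i, Module (MvPolynomial (Fin n) k) (F i)] {M : Type*} [AddCommGroup M]
    [Module (MvPolynomial (Fin n) k) M]
    (diff : ∀ i, F (i + 1) →ₗ[MvPolynomial (Fin n) k] F i)
    (ε : F 0 →ₗ[MvPolynomial (Fin n) k] M) : Prop where
  subsingleton : ∀ i < 0, Subsingleton (F i)
  free : ∀ i, Module.Free (MvPolynomial (Fin n) k) (F i)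
  surjective : Function.Surjective ε
  exact_zero : Function.Exact (diff 0) ε
  exact : ∀ i ≥ 0, Function.Exact (diff (i + 1)) (diff i)
  minimal : ∀ i x, diff i x ∈
    Ideal.span (Set.range (MvPolynomial.X : Fin n → MvPolynomial (Fin n) k)) •
      (⊤ : Submodule (MvPolynomial (Fin n) k) (F i))

/-- The family `G` of components makes `F` a graded free `k[x]`-module `⨁ k[x](-δ_b)`: there is a
basis of elements `b` to which degrees `δ_b` are assigned in such a way that the
component of degree `t` consists of the sums of elements `f b` with `deg f + δ_b = t`. -/
def IsGradedFree {F : Type*} [AddCommGroup F] [Module (MvPolynomial (Fin n) k) F]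
    (G : ℤ → AddSubgroup F) : Prop :=
  ∃ (I : Set F) (b : Module.Basis I (MvPolynomial (Fin n) k) F) (δ : I → ℤ), ∀ t,
    G t = AddSubgroup.closure {x | ∃ (j : I) (a : ℕ) (f : MvPolynomial (Fin n) k),
      f.IsHomogeneous a ∧ a + δ j = t ∧ x = f • b j}

/-- With the components `G i t` of degree `t` of `F_i`, the augmented complex `F` consists of
graded free modules and homogeneous maps of degree `0`. -/
structure IsGradedComplex {k : Type*} [Field k] {n : ℕ} {F : ℤ → Type*} [∀ i, AddCommGroup (F i)]
    [∀ i, Module (MvPolynomial (Fin n) k) (F i)] {M : Type*} [AddCommGroup M] [Module k M]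
    [Module (MvPolynomial (Fin n) k) M] (ℳ : ℤ → Submodule k M)
    (diff : ∀ i, F (i + 1) →ₗ[MvPolynomial (Fin n) k] F i)
    (ε : F 0 →ₗ[MvPolynomial (Fin n) k] M) (G : ∀ i, ℤ → AddSubgroup (F i)) : Prop where
  gradedFree : ∀ i, IsGradedFree (k := k) (n := n) (G i)
  diff_mem : ∀ i t, ∀ x ∈ G (i + 1) t, diff i x ∈ G i t
  ε_mem : ∀ t, ∀ x ∈ G 0 t, ε x ∈ ℳ t

variable {M : Type*} [AddCommGroup M] [Module k M]
  [Module (MvPolynomial (Fin n) k) M] [IsScalarTower k (MvPolynomial (Fin n) k) M]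
  {ℳ : ℤ → Submodule k M} {hℳ : IsStandardGrading n ℳ}

/-- A vertical splitting of the Koszul bicomplex is homogeneous if it preserves degrees. -/
def IsHomogeneousSplitting (S : VerticalSplitting (koszulBicomplex ℳ hℳ)) : Prop :=
  ∀ t, ∀ c ∈ koszulDegree n ℳ t, S.dplus c ∈ koszulDegree n ℳ t

end Resolution

end WallComplex

end

/-! With the differential `d₁ - d`, the total complex of the Koszul bicomplex is the Koszul complex
of the commuting operators `x_j ⊗ 1 + 1 ⊗ x_j` on `k[x] ⊗ M`. Polynomial division by the `j`-th
operator is a left inverse of it that commutes with the other operators, so this complex is exact in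
positive degrees (`koszulMap_diagAct_exact`). Its cokernel in degree `0` is `M`, through `f ⊗ m ↦
(-1)^{deg m} f m` (`koszulAugment_exact`).

The Wall complex is the result of homological perturbation. Put `u = ∑ (d₁ d⁺)^j`, the inverse of `1
- d₁ d⁺`; the sum is finite on each element because `d₁ d⁺` lowers the degree in `M`, which is
bounded below. Then `D = ∑ ω_j` is `P u d₁` on `H`. The maps `(1 + d⁺ u d₁) P` and `P u` are chain
maps between `H` and the total complex. One composite is the identity of `H`, the other is homotopic
to the identity through `d⁺ u`. These are identities in an arbitrary ring (`inclusion_comm`,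
`projection_comm`, `projection_inclusion`, `inclusion_projection`), and they carry the resolution of
`M` over to `H`. Minimality holds because `d₁` has values in `𝔪 K` and `P u` is linear over `k[x]`.

Freeness needs a separate argument, since `d⁺` need not be defined over `k`. The vertical
differential is, so it has a graded splitting over `k`, whose homology projection `P₁` has as its
image a vector space tensored with `k[x]`. From `P P₁ P = P` and `P₁ P P₁ = P₁`, the images of `P`
and `P₁` are isomorphic, and a homogeneous basis is transported to `H` (`exists_derived_basis`).

The natural Wall complex is isomorphic to the derived one by sending an element of `H` to its class
(`derivedIsoNatural`). -/

noncomputable section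

universe u v

namespace WallComplex

/-! ## Perturbation of a splitting -/

section Perturbation

variable {A : Type*} [Ring A]

/-- The relations of the perturbation lemma: a differential `d` with a splitting `s`, a second
differential `e` that anticommutes with `d`, and an inverse `u` of `1 - e s`. -/
structure PerturbationData (d e s u : A) : Prop where
  dd : d * d = 0
  ee : e * e = 0
  de : d * e = -(e * d)
  ss : s * s = 0
  dsd : d * s * d = d
  sds : s * d * s = s
  left_inv : u * (1 - e * s) = 1
  right_inv : (1 - e * s) * u = 1

namespace PerturbationData

variable {d e s u : A} (h : PerturbationData d e s u)
include h

lemma d_proj : d * (1 - d * s - s * d) = 0 := by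
  have h1 := h.dd
  have h2 := h.dsd
  simp only [mul_sub, mul_one, ← mul_assoc, h1, h2]; simp

lemma proj_d : (1 - d * s - s * d) * d = 0 := by
  have h1 := h.dd
  have h2 := h.dsd
  simp only [sub_mul, one_mul, h2, mul_assoc s d d, h1]; simp

lemma s_proj : s * (1 - d * s - s * d) = 0 := by
  have h1 := h.ss
  have h2 := h.sds
  simp only [mul_sub, mul_one, ← mul_assoc, h1, h2]; simp

lemma proj_s : (1 - d * s - s * d) * s = 0 := by
  have h1 := h.ss
  have h2 := h.sds
  simp only [sub_mul, one_mul, h2, mul_assoc d s s, h1]; simp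

lemma proj_proj : (1 - d * s - s * d) * (1 - d * s - s * d) = 1 - d * s - s * d := by
  have h1 := h.proj_d
  have h2 := h.proj_s
  set P := 1 - d * s - s * d with hP
  calc P * P = P * (1 - d * s - s * d) := by rw [← hP]
    _ = P - P * d * s - P * s * d := by noncomm_ring
    _ = P := by rw [h1, h2]; simp

lemma u_eq : u = 1 + u * (e * s) := by
  have := h.left_inv
  rw [mul_sub, mul_one, sub_eq_iff_eq_add] at this
  exact this

lemma u_eq' : u = 1 + e * s * u := by
  have := h.right_inv
  rw [sub_mul, one_mul, sub_eq_iff_eq_add] at this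
  exact this

/-- `1 + s u e` is the inverse of `1 - s e`. -/
lemma v_left_inv : (1 + s * u * e) * (1 - s * e) = 1 := by
  calc (1 + s * u * e) * (1 - s * e) = 1 - s * e + s * (u * (1 - e * s)) * e := by noncomm_ring
    _ = 1 := by rw [h.left_inv]; simp

lemma v_right_inv : (1 - s * e) * (1 + s * u * e) = 1 := by
  calc (1 - s * e) * (1 + s * u * e) = 1 - s * e + s * ((1 - e * s) * u) * e := by noncomm_ring
    _ = 1 := by rw [h.right_inv]; simp

lemma v_eq : 1 + s * u * e = 1 + s * e * (1 + s * u * e) := by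
  have := h.v_right_inv
  rw [sub_mul, one_mul, sub_eq_iff_eq_add] at this
  exact this

lemma e_v : e * (1 + s * u * e) = u * e := by
  calc e * (1 + s * u * e) = (1 + e * s * u) * e := by noncomm_ring
    _ = u * e := by rw [← h.u_eq']

lemma proj_v : (1 - d * s - s * d) * (1 + s * u * e) = 1 - d * s - s * d := by
  rw [mul_add, ← mul_assoc, ← mul_assoc, h.proj_s]; simp

/-- The inclusion followed by the projection is the identity of the homology. -/
lemma projection_inclusion :
    (1 - d * s - s * d) * u * ((1 + s * u * e) * (1 - d * s - s * d)) = 1 - d * s - s * d := by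
  have h1 := h.s_proj
  have h2 := h.ss
  have h3 : s * ((1 + s * u * e) * (1 - d * s - s * d)) = 0 := by
    rw [add_mul, mul_add, one_mul, h1, zero_add, ← mul_assoc, ← mul_assoc, ← mul_assoc, h2]
    simp
  nth_rewrite 1 [h.u_eq]
  rw [mul_add, mul_one, add_mul, ← mul_assoc _ _ (1 - d * s - s * d), h.proj_v, h.proj_proj]
  have : (1 - d * s - s * d) * (u * (e * s)) * ((1 + s * u * e) * (1 - d * s - s * d)) =
    (1 - d * s - s * d) * u * e * (s * ((1 + s * u * e) * (1 - d * s - s * d))) := by noncomm_ring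
  rw [this, h3, mul_zero, add_zero]

/-- Since `1 + s u e` is the inverse of `1 - s e`, it suffices to multiply by `1 - s e` on the left.
With `P = 1 - d s - s d` and `y = (1 + s u e) P`, one has `y = P + s e y`, so `d y = d s e y`. Then
`e² = 0` and `d e = -e d` reduce the product to `e y - d s e y - s d e y = P e y`, where `e y = u e
P`. -/
lemma inclusion_comm : (e - d) * ((1 + s * u * e) * (1 - d * s - s * d)) =
    (1 + s * u * e) * ((1 - d * s - s * d) * u * e * (1 - d * s - s * d)) := by
  have hy : (1 + s * u * e) * (1 - d * s - s * d) =
      (1 - d * s - s * d) + s * e * ((1 + s * u * e) * (1 - d * s - s * d)) := by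
    nth_rewrite 1 [h.v_eq]
    rw [add_mul, one_mul, mul_assoc]
  have hdy : d * ((1 + s * u * e) * (1 - d * s - s * d)) =
      d * s * e * ((1 + s * u * e) * (1 - d * s - s * d)) := by
    nth_rewrite 1 [hy]
    rw [mul_add, h.d_proj, zero_add]
    noncomm_ring
  have hev : u * e * (1 - d * s - s * d) = e * ((1 + s * u * e) * (1 - d * s - s * d)) := by
    rw [← h.e_v, mul_assoc]
  have key : (1 - s * e) * ((e - d) * ((1 + s * u * e) * (1 - d * s - s * d))) =
      (1 - d * s - s * d) * u * e * (1 - d * s - s * d) := by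
    rw [mul_assoc ((1 - d * s - s * d) * u), mul_assoc (1 - d * s - s * d) u, ← mul_assoc u e, hev]
    generalize (1 + s * u * e) * (1 - d * s - s * d) = y at hdy ⊢
    calc (1 - s * e) * ((e - d) * y) = e * y - d * y - s * (e * e) * y + s * (e * d) * y := by
          noncomm_ring
      _ = e * y - d * y - s * (d * e) * y := by rw [h.ee, h.de]; noncomm_ring
      _ = _ := by rw [hdy]; noncomm_ring
  rw [← key, ← mul_assoc (1 + s * u * e), h.v_left_inv, one_mul]

/-- The mirror image of `inclusion_comm`: multiply by `1 - e s` on the right. For `z = P u` the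
equations `u = 1 + u e s` and `P d = 0` give `z d = z e s d`. -/
lemma projection_comm : (1 - d * s - s * d) * u * (e - d) =
    (1 - d * s - s * d) * u * e * ((1 - d * s - s * d) * u) := by
  have key : (1 - d * s - s * d) * u * (e - d) * (1 - e * s) =
      (1 - d * s - s * d) * u * e * (1 - d * s - s * d) := by
    have h1 : (1 - d * s - s * d) * u * d = (1 - d * s - s * d) * u * e * (s * d) := by
      nth_rewrite 1 [h.u_eq]
      rw [mul_add, mul_one, add_mul, h.proj_d, zero_add]
      noncomm_ring
    generalize (1 - d * s - s * d) * u = z at h1 ⊢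
    calc z * (e - d) * (1 - e * s) = z * e - z * d - z * (e * e) * s + z * (d * e) * s := by
          noncomm_ring
      _ = z * e - z * d - z * e * d * s := by rw [h.ee, h.de]; noncomm_ring
      _ = _ := by rw [h1]; noncomm_ring
  calc _ = (1 - d * s - s * d) * u * (e - d) * ((1 - e * s) * u) := by rw [h.right_inv, mul_one]
    _ = (1 - d * s - s * d) * u * (e - d) * (1 - e * s) * u := by noncomm_ring
    _ = _ := by rw [key, mul_assoc _ _ u]

/-- The homotopy is `s u`. After multiplication by the invertible elements `1 - s e` on the left and
`1 - e s` on the right, both sides become `1 - d s - s d`. -/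
lemma inclusion_projection : (1 + s * u * e) * ((1 - d * s - s * d) * u) =
    1 + (e - d) * (s * u) + s * u * (e - d) := by
  have hvs : (1 + s * u * e) * s = s * u := by
    calc (1 + s * u * e) * s = s * (1 + u * (e * s)) := by noncomm_ring
      _ = s * u := by rw [← h.u_eq]
  have key : (1 - s * e) * (1 + (e - d) * (s * u) + s * u * (e - d)) * (1 - e * s) =
      1 - d * s - s * d := by
    have h1 : s * u * (1 - e * s) = s := by rw [mul_assoc, h.left_inv, mul_one]
    have h2 : (1 - s * e) * (s * u) = s := by
      rw [← hvs, ← mul_assoc, h.v_right_inv, one_mul]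
    calc _ = (1 - s * e) * (1 - e * s) + (1 - s * e) * (e - d) * (s * u * (1 - e * s)) +
          (1 - s * e) * (s * u) * (e - d) * (1 - e * s) := by noncomm_ring
      _ = 1 - d * s - s * d + (s * (e * d) * s + s * (d * e) * s) +
          (s * (e * e) * s - s * (e * e) * s - s * (e * e) * s) := by
        rw [h1, h2]; noncomm_ring
      _ = _ := by rw [h.ee, h.de]; noncomm_ring
  rw [← key]
  calc _ = ((1 + s * u * e) * (1 - s * e)) * (1 + (e - d) * (s * u) + s * u * (e - d)) *
        ((1 - e * s) * u) := by noncomm_ring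
    _ = _ := by rw [h.v_left_inv, h.right_inv]; simp

/-- The homology projections of two splittings of `d` induce the identity on homology. -/
lemma proj_mul_proj_mul_proj (s' : A) :
    (1 - d * s - s * d) * (1 - d * s' - s' * d) * (1 - d * s - s * d) = 1 - d * s - s * d := by
  have h1 := h.proj_d
  have h2 := h.d_proj
  have h3 := h.proj_proj
  generalize 1 - d * s - s * d = P at *
  calc P * (1 - d * s' - s' * d) * P = P * P - P * d * s' * P - P * s' * (d * P) := by
        noncomm_ring
    _ = P := by rw [h1, h2, h3]; simp

end PerturbationData

/-- A splitting, regarded with the zero perturbation. -/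
lemma PerturbationData.of_splitting {d s : A} (hdd : d * d = 0) (hss : s * s = 0)
    (hdsd : d * s * d = d) (hsds : s * d * s = s) : PerturbationData d 0 s 1 :=
  ⟨hdd, by simp, by simp, hss, hdsd, hsds, by simp, by simp⟩

end Perturbation

/-! ## Locally nilpotent endomorphisms -/

section LocallyNilpotent

variable {R : Type*} [Ring R] {C : Type*} [AddCommGroup C] [Module R C] {N : Module.End R C}

lemma pow_apply_eq_zero_of_le {x : C} {i j : ℕ} (hij : i ≤ j) (h : (N ^ i) x = 0) :
    (N ^ j) x = 0 := by
  obtain ⟨l, rfl⟩ := Nat.exists_eq_add_of_le hij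
  rw [add_comm, pow_add, Module.End.mul_apply, h, map_zero]

lemma finsum_pow_eq_sum {x : C} {j : ℕ} (h : (N ^ j) x = 0) :
    ∑ᶠ i : ℕ, (N ^ i) x = ∑ i ∈ Finset.range j, (N ^ i) x := by
  refine finsum_eq_sum_of_support_subset _ fun i hi => ?_
  rw [Finset.coe_range, Set.mem_Iio]
  by_contra hij
  exact hi (pow_apply_eq_zero_of_le (not_lt.1 hij) h)

lemma finite_support_pow (hN : ∀ x, ∃ j : ℕ, (N ^ j) x = 0) (x : C) :
    (Function.support fun i : ℕ => (N ^ i) x).Finite := by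
  obtain ⟨j, hj⟩ := hN x
  refine (Set.finite_Iio j).subset fun i hi => ?_
  by_contra hij
  exact hi (pow_apply_eq_zero_of_le (not_lt.1 hij) hj)

/-- The geometric series `∑ N^j` of a locally nilpotent endomorphism. -/
def geomSeries (N : Module.End R C) (hN : ∀ x, ∃ j : ℕ, (N ^ j) x = 0) : Module.End R C where
  toFun x := ∑ᶠ i : ℕ, (N ^ i) x
  map_add' x y := by
    simp only [map_add]
    exact finsum_add_distrib (finite_support_pow hN x) (finite_support_pow hN y)
  map_smul' r x := by
    simp only [map_smul, RingHom.id_apply]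
    exact (smul_finsum' r (finite_support_pow hN x)).symm

lemma geomSeries_apply (hN : ∀ x, ∃ j : ℕ, (N ^ j) x = 0) (x : C) :
    geomSeries N hN x = ∑ᶠ i : ℕ, (N ^ i) x := rfl

lemma sub_mul_geomSeries (hN : ∀ x, ∃ j : ℕ, (N ^ j) x = 0) :
    (1 - N) * geomSeries N hN = 1 := by
  ext x
  obtain ⟨j, hj⟩ := hN x
  have := LinearMap.congr_fun (mul_neg_geom_sum N j) x
  simpa [geomSeries_apply, finsum_pow_eq_sum hj, hj] using this

lemma geomSeries_mul_sub (hN : ∀ x, ∃ j : ℕ, (N ^ j) x = 0) :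
    geomSeries N hN * (1 - N) = 1 := by
  ext x
  obtain ⟨j, hj⟩ := hN x
  have h1 : (N ^ j) ((1 - N) x) = 0 := by
    have : N ^ j * (1 - N) = (1 - N) * N ^ j := by
      rw [mul_sub, sub_mul, ← pow_succ, ← pow_succ']; simp
    rw [← Module.End.mul_apply, this, Module.End.mul_apply, hj, map_zero]
  have := LinearMap.congr_fun (geom_sum_mul_neg N j) x
  rw [Module.End.mul_apply, geomSeries_apply, finsum_pow_eq_sum h1]
  simpa [hj] using this

/-- An additive subgroup is allowed because the components of a fixed degree are not submodules over
the polynomial ring. -/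
lemma geomSeries_mem (hN : ∀ x, ∃ j : ℕ, (N ^ j) x = 0) {E : AddSubgroup C}
    (hE : ∀ x ∈ E, N x ∈ E) {x : C} (hx : x ∈ E) : geomSeries N hN x ∈ E := by
  have h : ∀ i : ℕ, (N ^ i) x ∈ E := fun i => by
    induction i with
    | zero => simpa
    | succ i ih => rw [pow_succ', Module.End.mul_apply]; exact hE _ ih
  exact finsum_induction (· ∈ E) E.zero_mem (fun _ _ => E.add_mem) h

end LocallyNilpotent

/-! ## The homology projection of a vertical splitting -/

namespace VerticalSplitting

section

variable {R : Type*} [Ring R] {C : Type*} [AddCommGroup C] [Module R C]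
  {B : Bicomplex R C} (S : VerticalSplitting B)

lemma d_P (x : C) : B.d (S.P x) = 0 := by
  simp only [P_apply, map_sub, S.dsd, dd]
  simp

lemma P_d (x : C) : S.P (B.d x) = 0 := by
  simp only [P_apply, dd, map_zero, S.dsd]
  simp

lemma P_of_mem (w : S.splitHomology) : S.P w = w := by
  obtain ⟨_, x, rfl⟩ := w
  change S.P (S.P x) = S.P x
  nth_rewrite 2 [P_apply]
  simp only [map_sub, P_d]
  have : S.P (S.dplus (B.d x)) = 0 := by
    simp only [P_apply, S.sds, S.ss, map_zero]
    simp
  rw [this]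
  simp

end

end VerticalSplitting

/-! ## Exactness of Koszul complexes -/

section KoszulExact

variable {R : Type*} [CommRing R] {N : Type*} [AddCommGroup N] [Module R N] {n : ℕ}

/-- The elements of exterior degree `i` of `⋀ V ⊗ N`. -/
def exteriorDegree (n : ℕ) (R : Type*) [CommRing R] (N : Type*) [AddCommGroup N] [Module R N]
    (i : ℤ) : Submodule R (Finset (Fin n) → N) where
  carrier := {c | ∀ σ, (σ.card : ℤ) ≠ i → c σ = 0}
  zero_mem' _ _ := rfl
  add_mem' ha hb σ hσ := by simp [ha σ hσ, hb σ hσ]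
  smul_mem' r _ ha σ hσ := by simp [ha σ hσ]

/-- The components of exterior degree `i`. -/
def exteriorProj (n : ℕ) (R : Type*) [CommRing R] (N : Type*) [AddCommGroup N] [Module R N]
    (i : ℤ) : (Finset (Fin n) → N) →ₗ[R] (Finset (Fin n) → N) :=
  LinearMap.pi fun σ => if (σ.card : ℤ) = i then LinearMap.proj σ else 0

lemma exteriorProj_apply (i : ℤ) (c : Finset (Fin n) → N) (σ : Finset (Fin n)) :
    exteriorProj n R N i c σ = if (σ.card : ℤ) = i then c σ else 0 := by
  simp only [exteriorProj, LinearMap.pi_apply]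
  split_ifs <;> rfl

lemma exteriorProj_mem (i : ℤ) (c : Finset (Fin n) → N) :
    exteriorProj n R N i c ∈ exteriorDegree n R N i := fun σ hσ => by
  rw [exteriorProj_apply, if_neg hσ]

lemma exteriorProj_of_mem {i : ℤ} {c : Finset (Fin n) → N} (hc : c ∈ exteriorDegree n R N i) :
    exteriorProj n R N i c = c := by
  funext σ
  rw [exteriorProj_apply]
  split_ifs with h
  · rfl
  · exact (hc σ h).symm

lemma koszulMap_mem_exteriorDegree (T : Fin n → N →ₗ[R] N) {i : ℤ} {c : Finset (Fin n) → N}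
    (hc : c ∈ exteriorDegree n R N (i + 1)) : koszulMap T c ∈ exteriorDegree n R N i := by
  intro σ hσ
  rw [koszulMap_apply]
  refine Finset.sum_eq_zero fun j hj => ?_
  rw [hc, map_zero, smul_zero]
  rw [Finset.card_insert_of_notMem (Finset.mem_compl.1 hj)]
  push_cast
  omega

/-- The homotopy `z^τ ⊗ m ↦ ± z^{τ ∪ j} ⊗ g m` for `j ∉ τ`, and `0` for `j ∈ τ`. -/
def koszulHomotopy (j : Fin n) (g : N →ₗ[R] N) :
    (Finset (Fin n) → N) →ₗ[R] (Finset (Fin n) → N) :=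
  LinearMap.pi fun σ =>
    if j ∈ σ then koszulSign j (σ.erase j) • (g ∘ₗ LinearMap.proj (σ.erase j)) else 0

lemma koszulHomotopy_apply_of_mem {j : Fin n} (g : N →ₗ[R] N) (c : Finset (Fin n) → N)
    {σ : Finset (Fin n)} (h : j ∈ σ) :
    koszulHomotopy j g c σ = koszulSign j (σ.erase j) • g (c (σ.erase j)) := by
  simp [koszulHomotopy, h]

lemma koszulHomotopy_apply_of_notMem {j : Fin n} (g : N →ₗ[R] N) (c : Finset (Fin n) → N)
    {σ : Finset (Fin n)} (h : j ∉ σ) : koszulHomotopy j g c σ = 0 := by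
  simp [koszulHomotopy, h]

lemma koszulHomotopy_mem_exteriorDegree (j : Fin n) (g : N →ₗ[R] N) {i : ℤ}
    {c : Finset (Fin n) → N} (hc : c ∈ exteriorDegree n R N i) :
    koszulHomotopy j g c ∈ exteriorDegree n R N (i + 1) := by
  intro σ hσ
  by_cases h : j ∈ σ
  · rw [koszulHomotopy_apply_of_mem g c h, hc, map_zero, smul_zero]
    have := Finset.card_erase_add_one h
    omega
  · exact koszulHomotopy_apply_of_notMem g c h

lemma koszulSign_mul_self (j : Fin n) (σ : Finset (Fin n)) :
    koszulSign j σ * koszulSign j σ = 1 := by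
  rw [koszulSign, ← mul_pow]; simp

/-- If `g` is a left inverse of `T j` that commutes with the other operators, then
`koszulHomotopy j g` contracts the Koszul complex to the part that does not involve `z_j`. -/
lemma koszulMap_homotopy_of_mem (T : Fin n → N →ₗ[R] N) {j : Fin n} {g : N →ₗ[R] N}
    (hg : g ∘ₗ T j = LinearMap.id) (hgT : ∀ l, l ≠ j → g ∘ₗ T l = T l ∘ₗ g)
    (c : Finset (Fin n) → N) {σ : Finset (Fin n)} (hj : j ∈ σ) :
    koszulMap T (koszulHomotopy j g c) σ + koszulHomotopy j g (koszulMap T c) σ = c σ := by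
  rw [koszulMap_apply, koszulHomotopy_apply_of_mem _ _ hj, koszulMap_apply]
  have hins : (σ.erase j)ᶜ = insert j σᶜ := by
    ext l; by_cases e : l = j <;> simp [e]
  -- The summand of index `j` in the second term is `g (T j (c σ)) = c σ`. The summands with `l ∉ σ`
  -- cancel in pairs between the two terms.
  rw [hins, Finset.sum_insert (by simpa using hj), map_add, smul_add, map_zsmul, smul_smul,
    koszulSign_mul_self, one_smul, Finset.insert_erase hj, ← LinearMap.comp_apply g, hg,
    LinearMap.id_apply, add_left_comm, map_sum, Finset.smul_sum, ← Finset.sum_add_distrib]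
  rw [Finset.sum_eq_zero, add_zero]
  intro l hl
  have hl' : l ∉ σ := by simpa using hl
  have hlj : l ≠ j := fun e => hl' (e ▸ hj)
  have hmem : j ∈ insert l σ := Finset.mem_insert_of_mem hj
  have herase : (insert l σ).erase j = insert l (σ.erase j) := by
    rw [Finset.erase_insert_of_ne hlj]
  have hsign := koszulSign_insert (j := j) (l := l) (σ := σ.erase j) (by simp)
    (by simp [hl']) hlj.symm
  rw [Finset.insert_erase hj] at hsign
  have hc := LinearMap.congr_fun (hgT l hlj) (c (insert l (σ.erase j)))
  simp only [LinearMap.comp_apply] at hc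
  rw [koszulHomotopy_apply_of_mem _ _ hmem, herase, map_zsmul, map_zsmul, hc, smul_smul,
    smul_smul, ← add_smul]
  have h1 := koszulSign_mul_self j (σ.erase j)
  have h2 := koszulSign_mul_self j (insert l (σ.erase j))
  have : koszulSign l σ * koszulSign j (insert l (σ.erase j)) +
      koszulSign j (σ.erase j) * koszulSign l (σ.erase j) = 0 := by
    set a := koszulSign j (σ.erase j)
    set b := koszulSign l σ
    set a' := koszulSign j (insert l (σ.erase j))
    set b' := koszulSign l (σ.erase j)
    -- The exchange rule `a b = -b' a'` multiplied by `a a'`, with `a² = a'² = 1`.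
    linear_combination a * a' * hsign - b * a' * h1 - a * b' * h2
  rw [this, zero_smul]

/-- Only the summand that removes the added `z_j` survives. As `g` is not a right inverse of `T j`,
the value need not be `c σ`, but it vanishes together with `c σ`. So a later contraction does not
spoil coefficients that are already zero. -/
lemma koszulMap_homotopy_of_notMem (T : Fin n → N →ₗ[R] N) {j : Fin n} {g : N →ₗ[R] N}
    (c : Finset (Fin n) → N) {σ : Finset (Fin n)} (hj : j ∉ σ) :
    koszulMap T (koszulHomotopy j g c) σ + koszulHomotopy j g (koszulMap T c) σ =
      T j (g (c σ)) := by
  rw [koszulMap_apply, koszulHomotopy_apply_of_notMem _ _ hj, add_zero,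
    Finset.sum_eq_single_of_mem j (by simpa using hj)]
  · rw [koszulHomotopy_apply_of_mem _ _ (Finset.mem_insert_self _ _), Finset.erase_insert hj,
      map_zsmul, smul_smul, koszulSign_mul_self, one_smul]
  · intro l _ hl
    rw [koszulHomotopy_apply_of_notMem, map_zero, smul_zero]
    simp [hj, Ne.symm hl]

/-- If each operator `T j` has a left inverse that commutes with the other operators, then the
Koszul complex is exact in positive degrees. -/
lemma koszulMap_exact (T g : Fin n → N →ₗ[R] N) (hT : ∀ j l, T j ∘ₗ T l = T l ∘ₗ T j)
    (hg : ∀ j, g j ∘ₗ T j = LinearMap.id) (hgT : ∀ j l, l ≠ j → g j ∘ₗ T l = T l ∘ₗ g j)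
    {i : ℤ} (hi : 0 < i) {c : Finset (Fin n) → N} (hc : c ∈ exteriorDegree n R N i)
    (hTc : koszulMap T c = 0) :
    ∃ y ∈ exteriorDegree n R N (i + 1), koszulMap T y = c := by
  -- The variables are contracted one at a time: modulo boundaries, the cycle can be made to involve
  -- no `z_j` with `j ∈ s`.
  have key : ∀ s : Finset (Fin n), ∃ y ∈ exteriorDegree n R N (i + 1),
      ∀ σ, ¬ Disjoint σ s → (c - koszulMap T y) σ = 0 := by
    intro s
    induction s using Finset.induction_on with
    | empty => exact ⟨0, Submodule.zero_mem _, fun σ h => absurd (Finset.disjoint_empty_right σ) h⟩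
    | insert j s hjs ih =>
      obtain ⟨y, hy, hys⟩ := ih
      set b := c - koszulMap T y with hb
      have hTb : koszulMap T b = 0 := by
        rw [hb, map_sub, hTc, zero_sub, ← LinearMap.comp_apply, koszulMap_koszulMap T hT]
        simp
      have hbi : b ∈ exteriorDegree n R N i :=
        Submodule.sub_mem _ hc (koszulMap_mem_exteriorDegree T hy)
      refine ⟨y + koszulHomotopy j (g j) b,
        Submodule.add_mem _ hy (koszulHomotopy_mem_exteriorDegree j (g j) hbi), fun σ hσ => ?_⟩
      have e : (c - koszulMap T (y + koszulHomotopy j (g j) b)) σ =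
          b σ - koszulMap T (koszulHomotopy j (g j) b) σ := by
        rw [map_add, ← sub_sub, ← hb, Pi.sub_apply]
      have h0 : koszulHomotopy j (g j) (koszulMap T b) σ = 0 := by rw [hTb, map_zero]; rfl
      rw [e]
      by_cases hj : j ∈ σ
      · have := koszulMap_homotopy_of_mem T (hg j) (hgT j) b hj
        rw [h0, add_zero] at this
        rw [this, sub_self]
      · have := koszulMap_homotopy_of_notMem T (g := g j) b hj
        rw [h0, add_zero] at this
        have hb0 : b σ = 0 := hys σ fun h => hσ (Finset.disjoint_insert_right.2 ⟨hj, h⟩)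
        rw [this, hb0]
        simp
  obtain ⟨y, hy, h⟩ := key Finset.univ
  refine ⟨y, hy, (sub_eq_zero.1 (funext fun σ => ?_)).symm⟩
  -- Once all variables are contracted only the coefficient at `∅` is left, and it is zero because
  -- `i > 0`.
  by_cases hσ : σ = ∅
  · exact Submodule.sub_mem _ hc (koszulMap_mem_exteriorDegree T hy) σ (by simp [hσ, hi.ne])
  · exact h σ fun hd => hσ (Finset.eq_empty_of_forall_notMem fun l hl =>
      Finset.disjoint_left.1 hd hl (Finset.mem_univ l))

end KoszulExact

/-! ## The diagonal operators -/

section Diagonal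

variable {k : Type*} [Field k] {n : ℕ} {M : Type*} [AddCommGroup M] [Module k M]

open MvPolynomial

lemma tensor_hom_ext {Y : Type*} [AddCommGroup Y] [Module k Y]
    {f g : MvPolynomial (Fin n) k ⊗[k] M →ₗ[k] Y}
    (h : ∀ s m, f (monomial s 1 ⊗ₜ m) = g (monomial s 1 ⊗ₜ m)) : f = g := by
  refine TensorProduct.ext ((basisMonomials (Fin n) k).ext fun s => LinearMap.ext fun m => ?_)
  simpa using h s m

lemma X_mul_monomial_one (j : Fin n) (s : Fin n →₀ ℕ) :
    (X j * monomial s 1 : MvPolynomial (Fin n) k) = monomial (s + Finsupp.single j 1) 1 := by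
  rw [X, monomial_mul, add_comm, mul_one]

variable [Module (MvPolynomial (Fin n) k) M] [IsScalarTower k (MvPolynomial (Fin n) k) M]

/-- Division by `x_j ⊗ 1 + 1 ⊗ x_j` on `k[x] ⊗ M`. -/
def diagDiv (j : Fin n) :
    MvPolynomial (Fin n) k ⊗[k] M →ₗ[k] MvPolynomial (Fin n) k ⊗[k] M :=
  TensorProduct.lift ((basisMonomials (Fin n) k).constr k fun s =>
    ∑ b ∈ Finset.range (s j),
      (TensorProduct.mk k (MvPolynomial (Fin n) k) M
        (monomial (s - Finsupp.single j (b + 1)) 1)) ∘ₗ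
        (Algebra.lsmul k k M ((-X j : MvPolynomial (Fin n) k) ^ b)))

/-- With `k[x] ⊗ M` seen as polynomials with coefficients in `M`, this is the quotient of `x^s m` by
the monic `x_j - a`, where `a` acts on `M` as `-x_j`: the sum of `x^{s - (b+1) e_j} a^b m` over `b <
s_j`. The remainder is dropped, so the map is linear over `k` but not over `k[x]`. -/
lemma diagDiv_monomial (j : Fin n) (s : Fin n →₀ ℕ) (m : M) :
    diagDiv (k := k) j (monomial s 1 ⊗ₜ m) = ∑ b ∈ Finset.range (s j),
      (monomial (s - Finsupp.single j (b + 1)) (1 : k)) ⊗ₜ[k]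
        ((-X j : MvPolynomial (Fin n) k) ^ b • m) := by
  have := (basisMonomials (Fin n) k).constr_basis k (fun s =>
    ∑ b ∈ Finset.range (s j),
      (TensorProduct.mk k (MvPolynomial (Fin n) k) M
        (monomial (s - Finsupp.single j (b + 1)) 1)) ∘ₗ
        (Algebra.lsmul k k M ((-X j : MvPolynomial (Fin n) k) ^ b))) s
  rw [coe_basisMonomials] at this
  rw [diagDiv, TensorProduct.lift.tmul, this, LinearMap.sum_apply]
  rfl

/-- The operators `x_j ⊗ 1 + 1 ⊗ x_j` on `k[x] ⊗ M`. -/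
def diagAct (n : ℕ) (k : Type*) [Field k] (M : Type*) [AddCommGroup M] [Module k M]
    [Module (MvPolynomial (Fin n) k) M] [IsScalarTower k (MvPolynomial (Fin n) k) M] (j : Fin n) :
    MvPolynomial (Fin n) k ⊗[k] M →ₗ[MvPolynomial (Fin n) k] MvPolynomial (Fin n) k ⊗[k] M :=
  xAct n k M j - yAct n k M j

lemma diagAct_tmul (j : Fin n) (f : MvPolynomial (Fin n) k) (m : M) :
    diagAct n k M j (f ⊗ₜ m) =
      (X j * f) ⊗ₜ m + f ⊗ₜ ((X j : MvPolynomial (Fin n) k) • m) := by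
  simp [diagAct, TensorProduct.tmul_neg]

lemma diagAct_comm (j l : Fin n) :
    diagAct n k M j ∘ₗ diagAct n k M l = diagAct n k M l ∘ₗ diagAct n k M j := by
  simp only [diagAct, LinearMap.sub_comp, LinearMap.comp_sub, xAct_comm j l, yAct_comm j l,
    yAct_xAct j l, ← yAct_xAct l j]
  abel

/-- The sum telescopes: multiplication by `x_j` adds one summand to the quotient. Its term `b = 0`
is the original tensor, and the others cancel against the quotient of the second half of `diagAct`.
-/
lemma diagDiv_diagAct (j : Fin n) :
    diagDiv j ∘ₗ (diagAct n k M j).restrictScalars k = LinearMap.id := by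
  refine tensor_hom_ext fun s m => ?_
  have h : ∀ b, (s + Finsupp.single j 1) - Finsupp.single j (b + 1) = s - Finsupp.single j b := by
    intro b; rw [Finsupp.single_add, add_tsub_add_eq_tsub_right]
  simp only [LinearMap.comp_apply, LinearMap.restrictScalars_apply, diagAct_tmul, map_add,
    X_mul_monomial_one, diagDiv_monomial, LinearMap.id_apply, h]
  rw [Finsupp.add_apply, Finsupp.single_eq_same, Finset.sum_range_succ']
  have : ∀ b, (-X j : MvPolynomial (Fin n) k) ^ b • (X j : MvPolynomial (Fin n) k) • m =
      -((-X j : MvPolynomial (Fin n) k) ^ (b + 1) • m) := by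
    intro b; rw [pow_succ, mul_smul, neg_smul, smul_neg, neg_neg]
  simp only [this, TensorProduct.tmul_neg, Finset.sum_neg_distrib]
  simp

/-- Multiplication by `x_l` leaves the exponent of `x_j`, hence the length of the quotient,
unchanged. -/
lemma diagDiv_diagAct_of_ne {j l : Fin n} (hl : l ≠ j) :
    diagDiv j ∘ₗ (diagAct n k M l).restrictScalars k =
      (diagAct n k M l).restrictScalars k ∘ₗ diagDiv j := by
  refine tensor_hom_ext fun s m => ?_
  simp only [LinearMap.comp_apply, LinearMap.restrictScalars_apply, diagAct_tmul, map_add,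
    X_mul_monomial_one, diagDiv_monomial, map_sum]
  rw [Finsupp.add_apply, Finsupp.single_eq_of_ne hl.symm, add_zero, ← Finset.sum_add_distrib]
  refine Finset.sum_congr rfl fun b hb => ?_
  -- Subtraction of exponents is truncated; for `b < s j` it is a genuine subtraction.
  have hle : Finsupp.single j (b + 1) ≤ s := by
    rw [Finsupp.single_le_iff]
    exact Finset.mem_range.1 hb
  rw [tsub_add_eq_add_tsub hle, smul_smul, smul_smul, mul_comm]

/-- The Koszul complex of the diagonal operators is exact in positive degrees. -/
lemma koszulMap_diagAct_exact {i : ℤ} (hi : 0 < i) {c : KoszulModule n k M}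
    (hc : c ∈ exteriorDegree n (MvPolynomial (Fin n) k) (MvPolynomial (Fin n) k ⊗[k] M) i)
    (hTc : koszulMap (diagAct n k M) c = 0) :
    ∃ y ∈ exteriorDegree n (MvPolynomial (Fin n) k) (MvPolynomial (Fin n) k ⊗[k] M) (i + 1),
      koszulMap (diagAct n k M) y = c := by
  have e : ∀ c, koszulMap (fun j => (diagAct n k M j).restrictScalars k) c =
      koszulMap (diagAct n k M) c := fun c => by
    funext σ
    simp [koszulMap_apply]
  -- The left inverses are only `k`-linear, so exactness is proved over `k`; cycles and boundaries
  -- are the same elements.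
  have := koszulMap_exact (R := k) (fun j => (diagAct n k M j).restrictScalars k) diagDiv
    (fun j l => LinearMap.ext fun x =>
      LinearMap.congr_fun (diagAct_comm (k := k) (M := M) j l) x)
    diagDiv_diagAct (fun j l hl => diagDiv_diagAct_of_ne hl) hi hc (by rw [e, hTc])
  simp only [e] at this
  exact this

end Diagonal

/-! ## Linear maps on internal direct sums -/

section InternalLift

variable {R : Type*} [Ring R] {ι : Type*} [DecidableEq ι]
  {C : Type*} [AddCommGroup C] [Module R C] {W : Type*} [AddCommGroup W] [Module R W]

/-- The linear map on an internal direct sum that is given on the summands. -/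
def internalLift {A : ι → Submodule R C} (h : DirectSum.IsInternal A) (g : ∀ i, A i →ₗ[R] W) :
    C →ₗ[R] W :=
  DirectSum.toModule R ι W g ∘ₗ
    (LinearEquiv.ofBijective (DirectSum.coeLinearMap A) h).symm.toLinearMap

lemma internalLift_of_mem {A : ι → Submodule R C} (h : DirectSum.IsInternal A)
    (g : ∀ i, A i →ₗ[R] W) {i : ι} {x : C} (hx : x ∈ A i) :
    internalLift h g x = g i ⟨x, hx⟩ := by
  have : (LinearEquiv.ofBijective (DirectSum.coeLinearMap A) h).symm x =
      DirectSum.lof R ι (fun i => A i) i ⟨x, hx⟩ := by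
    exact (LinearEquiv.symm_apply_eq _).2 (DirectSum.coeLinearMap_lof A i ⟨x, hx⟩).symm
  rw [internalLift, LinearMap.comp_apply, LinearEquiv.coe_coe, this, DirectSum.toModule_lof]

lemma internal_hom_ext {A : ι → Submodule R C} (h : DirectSum.IsInternal A) {f g : C →ₗ[R] W}
    (hfg : ∀ i, ∀ x ∈ A i, f x = g x) : f = g := by
  have : ⨆ i, A i ≤ LinearMap.eqLocus f g := iSup_le fun i x hx => hfg i x hx
  exact LinearMap.ext fun x => this (h.submodule_iSup_eq_top ▸ Submodule.mem_top)

end InternalLift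

/-! ## The augmentation -/

section Augmentation

variable {k : Type*} [Field k] {n : ℕ} {M : Type*} [AddCommGroup M] [Module k M]

/-- The map `m ↦ (-1)^d m` for `m` of degree `d`. -/
def signMap {ℳ : ℤ → Submodule k M} (h : DirectSum.IsInternal ℳ) : M →ₗ[k] M :=
  internalLift h fun d => (d.negOnePow : ℤ) • (ℳ d).subtype

lemma signMap_of_mem {ℳ : ℤ → Submodule k M} (h : DirectSum.IsInternal ℳ) {d : ℤ} {m : M}
    (hm : m ∈ ℳ d) : signMap h m = (d.negOnePow : ℤ) • m := by
  rw [signMap, internalLift_of_mem h _ hm]; rfl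

lemma signMap_mem {ℳ : ℤ → Submodule k M} (h : DirectSum.IsInternal ℳ) {d : ℤ} {m : M}
    (hm : m ∈ ℳ d) : signMap h m ∈ ℳ d := by
  rw [signMap_of_mem h hm]; exact zsmul_mem hm _

lemma signMap_signMap {ℳ : ℤ → Submodule k M} (h : DirectSum.IsInternal ℳ) (m : M) :
    signMap h (signMap h m) = m := by
  have : signMap h ∘ₗ signMap h = LinearMap.id := internal_hom_ext h fun d x hx => by
    rw [LinearMap.comp_apply, signMap_of_mem h hx, map_zsmul, signMap_of_mem h hx, smul_smul,
      ← Units.val_mul, Int.units_mul_self]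
    simp
  exact LinearMap.congr_fun this m

variable [Module (MvPolynomial (Fin n) k) M]

open MvPolynomial

lemma X_pow_smul_mem {ℳ : ℤ → Submodule k M} (h : IsStandardGrading n ℳ) (j : Fin n) (a : ℕ)
    {d : ℤ} {m : M} (hm : m ∈ ℳ d) : (X j ^ a : MvPolynomial (Fin n) k) • m ∈ ℳ (d + a) := by
  induction a with
  | zero => simpa
  | succ a ih =>
    rw [pow_succ', mul_smul]
    have := h.X_smul_mem j _ _ ih
    rwa [add_assoc] at this

variable [IsScalarTower k (MvPolynomial (Fin n) k) M]

/-- A variable raises the degree by one and so flips the sign. This is what lets the augmentation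
kill `x_j ⊗ 1 + 1 ⊗ x_j` although both summands act with a plus sign. -/
lemma signMap_X_smul {ℳ : ℤ → Submodule k M} (h : IsStandardGrading n ℳ) (j : Fin n) (m : M) :
    signMap h.isInternal ((X j : MvPolynomial (Fin n) k) • m) =
      -((X j : MvPolynomial (Fin n) k) • signMap h.isInternal m) := by
  have : signMap h.isInternal ∘ₗ Algebra.lsmul k k M (X j : MvPolynomial (Fin n) k) =
      -(Algebra.lsmul k k M (X j : MvPolynomial (Fin n) k) ∘ₗ signMap h.isInternal) :=
    internal_hom_ext h.isInternal fun d x hx => by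
      simp only [LinearMap.comp_apply, LinearMap.neg_apply, Algebra.lsmul_coe]
      rw [signMap_of_mem _ hx, signMap_of_mem _ (h.X_smul_mem j d x hx), Int.negOnePow_succ,
        Units.val_neg, neg_smul, smul_comm]
  exact LinearMap.congr_fun this m

lemma monomial_smul_mem {ℳ : ℤ → Submodule k M} (h : IsStandardGrading n ℳ) (s : Fin n →₀ ℕ)
    (r : k) {d : ℤ} {m : M} (hm : m ∈ ℳ d) :
    (monomial s r : MvPolynomial (Fin n) k) • m ∈ ℳ (d + (s.degree : ℕ)) := by
  induction s using Finsupp.induction generalizing d m with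
  | zero =>
    have : (monomial 0 r : MvPolynomial (Fin n) k) • m = r • m := by
      change C r • m = _
      rw [← algebraMap_eq, algebraMap_smul]
    rw [this, map_zero, Nat.cast_zero, add_zero]
    exact (ℳ d).smul_mem r hm
  | single_add j a s _ _ ih =>
    have e : (monomial (Finsupp.single j a + s) r : MvPolynomial (Fin n) k) =
        X j ^ a * monomial s r := by rw [X_pow_eq_monomial, monomial_mul, one_mul]
    rw [e, mul_smul, map_add, Finsupp.degree_single]
    have := X_pow_smul_mem h j a (ih hm)
    convert this using 2
    push_cast
    ring

lemma isHomogeneous_smul_mem {ℳ : ℤ → Submodule k M} (h : IsStandardGrading n ℳ) {a : ℕ}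
    {f : MvPolynomial (Fin n) k} (hf : f.IsHomogeneous a) {d : ℤ} {m : M} (hm : m ∈ ℳ d) :
    f • m ∈ ℳ (d + a) := by
  rw [f.as_sum, Finset.sum_smul]
  refine Submodule.sum_mem _ fun s hs => ?_
  have := monomial_smul_mem h s (f.coeff s) hm
  have hd : s.degree = a := by
    rw [Finsupp.degree_eq_weight_one]
    exact hf (mem_support_iff.1 hs)
  rwa [hd] at this

/-- The map `k[x] ⊗ M → M`, `f ⊗ m ↦ (-1)^{deg m} f m`. -/
def augment {ℳ : ℤ → Submodule k M} (h : IsStandardGrading n ℳ) :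
    MvPolynomial (Fin n) k ⊗[k] M →ₗ[MvPolynomial (Fin n) k] M :=
  (signMap h.isInternal).liftBaseChange (MvPolynomial (Fin n) k)

lemma augment_tmul {ℳ : ℤ → Submodule k M} (h : IsStandardGrading n ℳ)
    (f : MvPolynomial (Fin n) k) (m : M) :
    augment h (f ⊗ₜ m) = f • signMap h.isInternal m := by
  simp [augment]

lemma augment_diagAct {ℳ : ℤ → Submodule k M} (h : IsStandardGrading n ℳ) (j : Fin n)
    (x : MvPolynomial (Fin n) k ⊗[k] M) : augment h (diagAct n k M j x) = 0 := by
  induction x with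
  | zero => simp
  | add a b ha hb => simp [ha, hb]
  | tmul f m =>
    rw [diagAct_tmul, map_add, augment_tmul, augment_tmul, signMap_X_smul h, smul_neg, smul_smul,
      mul_comm, add_neg_cancel]

/-- Modulo the images of the diagonal operators a variable moves from the left factor to the right
one at the cost of a sign, so every element is congruent to some `1 ⊗ m`. The augmentation
determines this `m`. Hence its kernel is the sum of the images. -/
lemma sub_augment_mem {ℳ : ℤ → Submodule k M} (h : IsStandardGrading n ℳ)
    (x : MvPolynomial (Fin n) k ⊗[k] M) :
    x - 1 ⊗ₜ signMap h.isInternal (augment h x) ∈ ⨆ j, LinearMap.range (diagAct n k M j) := by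
  induction x with
  | zero => simp
  | add a b ha hb =>
    rw [map_add, map_add, TensorProduct.tmul_add, add_sub_add_comm]
    exact Submodule.add_mem _ ha hb
  | tmul f m =>
    induction f using MvPolynomial.induction_on generalizing m with
    | C r =>
      have : (C r : MvPolynomial (Fin n) k) = r • 1 := by
        rw [← algebraMap_eq, Algebra.algebraMap_eq_smul_one]
      rw [augment_tmul, this, smul_assoc, one_smul, map_smul, signMap_signMap,
        TensorProduct.smul_tmul, sub_self]
      exact Submodule.zero_mem _
    | add a b ha hb =>
      rw [TensorProduct.add_tmul, map_add, map_add, TensorProduct.tmul_add, add_sub_add_comm]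
      exact Submodule.add_mem _ (ha m) (hb m)
    | mul_X f j ih =>
      have h1 : (f * X j) ⊗ₜ[k] m =
          diagAct n k M j (f ⊗ₜ m) - f ⊗ₜ ((X j : MvPolynomial (Fin n) k) • m) := by
        rw [diagAct_tmul, mul_comm, add_sub_cancel_right]
      have h2 := Submodule.sub_mem _ (Submodule.mem_iSup_of_mem (p := fun j =>
        LinearMap.range (diagAct n k M j)) j ⟨f ⊗ₜ m, rfl⟩)
        (ih ((X j : MvPolynomial (Fin n) k) • m))
      convert h2 using 1
      rw [h1, map_sub, augment_diagAct, zero_sub, map_neg, TensorProduct.tmul_neg]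
      abel

/-- The augmentation of the Koszul complex of the diagonal operators. -/
def koszulAugment {ℳ : ℤ → Submodule k M} (h : IsStandardGrading n ℳ) :
    KoszulModule n k M →ₗ[MvPolynomial (Fin n) k] M :=
  augment h ∘ₗ LinearMap.proj ∅

lemma koszulAugment_apply {ℳ : ℤ → Submodule k M} (h : IsStandardGrading n ℳ)
    (c : KoszulModule n k M) : koszulAugment h c = augment h (c ∅) := rfl

lemma koszulAugment_koszulMap {ℳ : ℤ → Submodule k M} (h : IsStandardGrading n ℳ)
    (c : KoszulModule n k M) : koszulAugment h (koszulMap (diagAct n k M) c) = 0 := by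
  rw [koszulAugment_apply, koszulMap_apply, map_sum]
  exact Finset.sum_eq_zero fun j _ => by rw [map_zsmul, augment_diagAct, smul_zero]

lemma koszulAugment_surjective {ℳ : ℤ → Submodule k M} (h : IsStandardGrading n ℳ) (m : M) :
    ∃ c ∈ exteriorDegree n (MvPolynomial (Fin n) k) (MvPolynomial (Fin n) k ⊗[k] M) 0,
      koszulAugment h c = m := by
  refine ⟨Pi.single ∅ (1 ⊗ₜ signMap h.isInternal m), fun σ hσ => ?_, ?_⟩
  · refine Pi.single_eq_of_ne ?_ _
    rintro rfl
    simp at hσ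
  · rw [koszulAugment_apply, Pi.single_eq_same, augment_tmul, one_smul, signMap_signMap]

lemma koszulAugment_exact {ℳ : ℤ → Submodule k M} (h : IsStandardGrading n ℳ)
    {c : KoszulModule n k M}
    (hc : c ∈ exteriorDegree n (MvPolynomial (Fin n) k) (MvPolynomial (Fin n) k ⊗[k] M) 0)
    (h0 : koszulAugment h c = 0) :
    ∃ y ∈ exteriorDegree n (MvPolynomial (Fin n) k) (MvPolynomial (Fin n) k ⊗[k] M) 1,
      koszulMap (diagAct n k M) y = c := by
  have h1 := sub_augment_mem h (c ∅)
  rw [← koszulAugment_apply, h0, map_zero, TensorProduct.tmul_zero, sub_zero] at h1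
  have hc' : c = Pi.single ∅ (c ∅) := by
    funext σ
    by_cases hσ : σ = ∅
    · subst hσ; simp
    · rw [Pi.single_eq_of_ne hσ]
      exact hc σ (by simpa using hσ)
  rw [hc']
  generalize c ∅ = x at h1
  induction h1 using Submodule.iSup_induction' with
  | zero => exact ⟨0, Submodule.zero_mem _, by simp⟩
  | add a b _ _ ha hb =>
    obtain ⟨y, hy, e⟩ := ha
    obtain ⟨z, hz, e'⟩ := hb
    exact ⟨y + z, Submodule.add_mem _ hy hz, by rw [map_add, e, e', Pi.single_add]⟩
  | mem j x hx =>
    obtain ⟨z, rfl⟩ := hx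
    -- The boundary of `z_j ⊗ z` has the single term at `∅`, with sign `+1`.
    refine ⟨Pi.single {j} z, fun σ hσ => Pi.single_eq_of_ne ?_ _, ?_⟩
    · rintro rfl
      simp at hσ
    · rw [koszulMap_single]
      simp [koszulSign]

lemma koszulAugment_mem {ℳ : ℤ → Submodule k M} (h : IsStandardGrading n ℳ) {t : ℤ}
    {c : KoszulModule n k M} (hc : c ∈ koszulDegree n ℳ t) : koszulAugment h c ∈ ℳ t := by
  have : koszulDegree n ℳ t ≤ (ℳ t).toAddSubgroup.comap (koszulAugment h : _ →+ M) := by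
    refine (AddSubgroup.closure_le _).2 ?_
    rintro _ ⟨σ, a, e, f, m, hf, hm, rfl, rfl⟩
    change augment h ((Pi.single σ (f ⊗ₜ m) : KoszulModule n k M) ∅) ∈ ℳ _
    by_cases hσ : σ = ∅
    · subst hσ
      rw [Pi.single_eq_same, augment_tmul]
      have := isHomogeneous_smul_mem h hf (signMap_mem h.isInternal hm)
      convert this using 2
      simp [add_comm]
    · rw [Pi.single_eq_of_ne (Ne.symm hσ), map_zero]
      exact Submodule.zero_mem _
  exact this hc

end Augmentation

/-! ## Graded splittings over a field -/

section GradedSplitting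

variable {k : Type*} [Field k] {V : Type*} [AddCommGroup V] [Module k V]

/-- Every linear map between vector spaces has a generalized inverse. -/
lemma exists_generalized_inverse (δ : V →ₗ[k] V) : ∃ s : V →ₗ[k] V, δ ∘ₗ s ∘ₗ δ = δ := by
  obtain ⟨r, hr⟩ := δ.rangeRestrict.exists_rightInverse_of_surjective
    (LinearMap.range_eq_top.2 δ.surjective_rangeRestrict)
  -- A section of `δ` onto its range, extended arbitrarily to all of `V`.
  obtain ⟨s, hs⟩ := r.exists_extend
  refine ⟨s, LinearMap.ext fun x => ?_⟩
  have h1 : s (δ x) = r (δ.rangeRestrict x) := LinearMap.congr_fun hs (δ.rangeRestrict x)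
  have h2 := congrArg Subtype.val (LinearMap.congr_fun hr (δ.rangeRestrict x))
  simp only [LinearMap.comp_apply, h1]
  exact h2

/-- A generalized inverse `s` of a differential `δ` can be corrected to a splitting. -/
lemma splitting_of_generalized_inverse {A : Type*} [Ring A] {δ s : A} (h1 : δ * δ = 0)
    (h2 : δ * s * δ = δ) :
    let r := s * δ * s - s * δ * s * s * δ
    r * r = 0 ∧ δ * r * δ = δ ∧ r * δ * r = r := by
  -- Here `r = (s δ s)(1 - s δ)`. The element `s δ s` is a reflexive generalized inverse of `δ`. The
  -- idempotent `1 - s δ` annihilates `s δ` from the left, which gives `r² = 0`, and `δ² = 0`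
  -- preserves the other two identities.
  have h2' : ∀ a, δ * (s * (δ * a)) = δ * a := fun a => by
    rw [← mul_assoc, ← mul_assoc, h2]
  have h2'' : δ * (s * δ) = δ := by rw [← mul_assoc, h2]
  refine ⟨?_, ?_, ?_⟩ <;>
  simp only [mul_sub, sub_mul, mul_assoc, h1, h2', h2'', mul_zero, sub_zero, sub_self]

variable {ι : Type*} [DecidableEq ι] {𝒱 : ι → Submodule k V}

lemma gradedProj_mem (h : DirectSum.IsInternal 𝒱) (i : ι) (x : V) : gradedProj h i x ∈ 𝒱 i :=
  Subtype.property _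

lemma comp_gradedProj (h : DirectSum.IsInternal 𝒱) {φ : ι ≃ ι} {δ : V →ₗ[k] V}
    (hδ : ∀ i, ∀ x ∈ 𝒱 i, δ x ∈ 𝒱 (φ i)) (i : ι) :
    δ ∘ₗ gradedProj h i = gradedProj h (φ i) ∘ₗ δ := by
  refine internal_hom_ext h fun j x hx => ?_
  simp only [LinearMap.comp_apply]
  by_cases hij : i = j
  · subst hij
    rw [gradedProj_of_mem h hx, gradedProj_of_mem h (hδ _ _ hx)]
  · rw [gradedProj_of_mem_ne h hij hx, map_zero,
      gradedProj_of_mem_ne h (fun e => hij (φ.injective e)) (hδ _ _ hx)]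

/-- Of an arbitrary generalized inverse only the component of degree `φ⁻¹` is kept. As `δ` has
degree `φ`, it is still a generalized inverse, and the correction to a splitting is a polynomial in
`δ` and `s` that respects the degrees. -/
lemma exists_graded_splitting (h : DirectSum.IsInternal 𝒱) (φ : ι ≃ ι) {δ : V →ₗ[k] V}
    (hδ : ∀ i, ∀ x ∈ 𝒱 i, δ x ∈ 𝒱 (φ i)) (hδδ : δ ∘ₗ δ = 0) :
    ∃ s : V →ₗ[k] V, (∀ i, ∀ x ∈ 𝒱 i, s x ∈ 𝒱 (φ.symm i)) ∧
      s ∘ₗ s = 0 ∧ δ ∘ₗ s ∘ₗ δ = δ ∧ s ∘ₗ δ ∘ₗ s = s := by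
  obtain ⟨s₀, hs₀⟩ := exists_generalized_inverse δ
  let s : V →ₗ[k] V := internalLift h fun i => gradedProj h (φ.symm i) ∘ₗ s₀ ∘ₗ (𝒱 i).subtype
  have hs : ∀ i, ∀ x ∈ 𝒱 i, s x = gradedProj h (φ.symm i) (s₀ x) := fun i x hx =>
    internalLift_of_mem h _ hx
  have hsm : ∀ i, ∀ x ∈ 𝒱 i, s x ∈ 𝒱 (φ.symm i) := fun i x hx => by
    rw [hs i x hx]; exact gradedProj_mem h _ _
  have h2 : δ ∘ₗ s ∘ₗ δ = δ := internal_hom_ext h fun i x hx => by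
    have e := LinearMap.congr_fun (comp_gradedProj h hδ i) (s₀ (δ x))
    have e' := LinearMap.congr_fun hs₀ x
    simp only [LinearMap.comp_apply] at e e' ⊢
    rw [hs _ _ (hδ i x hx), Equiv.symm_apply_apply, e, e', gradedProj_of_mem h (hδ i x hx)]
  obtain ⟨h3, h4, h5⟩ := splitting_of_generalized_inverse (A := Module.End k V) (s := s) hδδ h2
  refine ⟨_, fun i x hx => ?_, h3, h4, h5⟩
  have hsd : ∀ i, ∀ x ∈ 𝒱 i, s (δ x) ∈ 𝒱 i := fun i x hx => by
    simpa using hsm _ _ (hδ i x hx)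
  have hds : ∀ i, ∀ x ∈ 𝒱 i, δ (s x) ∈ 𝒱 i := fun i x hx => by
    simpa using hδ _ _ (hsm i x hx)
  exact Submodule.sub_mem _ (hsm _ _ (hds _ _ hx)) (hsm _ _ (hds _ _ (hsd _ _ hx)))

lemma exists_homogeneous_basis {k : Type*} [Field k] {V : Type u} [AddCommGroup V] [Module k V]
    {ι : Type} [DecidableEq ι] {𝒱 : ι → Submodule k V} (h : DirectSum.IsInternal 𝒱) :
    ∃ (J : Type u) (deg : J → ι) (b : J → V), LinearIndependent k b ∧ (∀ j, b j ∈ 𝒱 (deg j)) ∧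
      ∀ i, 𝒱 i ≤ Submodule.span k (b '' {j | deg j = i}) := by
  have h0 : ∀ i, ∃ η : Type u, Nonempty (Module.Basis η k (𝒱 i)) := fun i =>
    ⟨_, ⟨Module.Basis.ofVectorSpace k (𝒱 i)⟩⟩
  choose η hη using h0
  let b₀ : ∀ i, Module.Basis (η i) k (𝒱 i) := fun i => (hη i).some
  refine ⟨Σ i, η i, Sigma.fst, fun j => (b₀ j.1 j.2 : V), ?_, fun j => (b₀ j.1 j.2).2,
    fun i x hx => ?_⟩
  · have := (h.collectedBasis b₀).linearIndependent
    rwa [h.collectedBasis_coe] at this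
  · have h1 : (⟨x, hx⟩ : 𝒱 i) ∈ Submodule.span k (Set.range (b₀ i)) := (b₀ i).mem_span _
    have h2 := Submodule.mem_map_of_mem (f := (𝒱 i).subtype) h1
    rw [Submodule.map_span, ← Set.range_comp] at h2
    refine Submodule.span_mono ?_ h2
    rintro _ ⟨l, rfl⟩
    exact ⟨⟨i, l⟩, rfl, rfl⟩

/-- The image of a graded idempotent has a basis of homogeneous elements. -/
lemma exists_homogeneous_basis_range {k : Type*} [Field k] {V : Type u} [AddCommGroup V]
    [Module k V] {ι : Type} [DecidableEq ι] {𝒱 : ι → Submodule k V}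
    (h : DirectSum.IsInternal 𝒱) {p : V →ₗ[k] V} (hp : ∀ i, ∀ x ∈ 𝒱 i, p x ∈ 𝒱 i)
    (hpp : ∀ x, p (p x) = p x) :
    ∃ (J : Type u) (deg : J → ι) (b : J → V), LinearIndependent k b ∧ (∀ j, b j ∈ 𝒱 (deg j)) ∧
      (∀ j, p (b j) = b j) ∧ ∀ i, ∀ x ∈ 𝒱 i, p x ∈ Submodule.span k (b '' {j | deg j = i}) := by
  have hI : DirectSum.IsInternal fun i => (𝒱 i).comap (LinearMap.range p).subtype :=
    isInternal_of_retract h p.rangeRestrict (LinearMap.range p).subtype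
      p.surjective_rangeRestrict (Submodule.injective_subtype _) (fun i x hx => hp i x hx)
      (fun i x hx => hx)
  obtain ⟨J, deg, b, h1, h2, h3⟩ := exists_homogeneous_basis hI
  refine ⟨J, deg, fun j => b j, h1.map' _ (Submodule.ker_subtype _), h2, fun j => ?_,
    fun i x hx => ?_⟩
  · obtain ⟨y, hy⟩ := (b j).2
    change p (b j) = b j
    rw [← hy, hpp]
  · have h4 := Submodule.mem_map_of_mem (f := (LinearMap.range p).subtype)
      (h3 i (show p.rangeRestrict x ∈ _ from hp i x hx))
    rw [Submodule.map_span, ← Set.image_comp] at h4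
    exact h4

end GradedSplitting

/-! ## The Koszul complex of `M` over the field -/

section BaseField

variable {k : Type*} [Field k] {n : ℕ} {M : Type*} [AddCommGroup M] [Module k M]

/-- The elements of `⋀^i V ⊗ M_e`. -/
def exteriorPiece (n : ℕ) (ℳ : ℤ → Submodule k M) (a : ℤ × ℤ) :
    Submodule k (Finset (Fin n) → M) :=
  Submodule.pi Set.univ fun σ => if (σ.card : ℤ) = a.1 then ℳ a.2 else ⊥

lemma mem_exteriorPiece {ℳ : ℤ → Submodule k M} {a : ℤ × ℤ} {c : Finset (Fin n) → M} :
    c ∈ exteriorPiece n ℳ a ↔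
      (∀ σ, (σ.card : ℤ) = a.1 → c σ ∈ ℳ a.2) ∧ ∀ σ, (σ.card : ℤ) ≠ a.1 → c σ = 0 := by
  simp only [exteriorPiece, Submodule.mem_pi, Set.mem_univ, true_imp_iff]
  constructor
  · intro h
    exact ⟨fun σ hσ => by simpa [hσ] using h σ, fun σ hσ => by simpa [hσ] using h σ⟩
  · rintro ⟨h1, h2⟩ σ
    split_ifs with h
    · exact h1 σ h
    · exact h2 σ h

lemma single_mem_exteriorPiece {ℳ : ℤ → Submodule k M} {σ : Finset (Fin n)} {e : ℤ} {m : M}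
    (hm : m ∈ ℳ e) : Pi.single σ m ∈ exteriorPiece n ℳ (σ.card, e) := by
  refine mem_exteriorPiece.2 ⟨fun τ _ => ?_, fun τ hτ => Pi.single_eq_of_ne ?_ _⟩
  · by_cases h : τ = σ
    · subst h; simpa using hm
    · rw [Pi.single_eq_of_ne h]; exact Submodule.zero_mem _
  · rintro rfl
    exact hτ rfl

lemma exteriorPiece_isInternal {ℳ : ℤ → Submodule k M} (h : DirectSum.IsInternal ℳ) :
    DirectSum.IsInternal (exteriorPiece n ℳ) := by
  refine isInternal_of_proj (fun a => LinearMap.pi fun σ =>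
    if (σ.card : ℤ) = a.1 then gradedProj h a.2 ∘ₗ LinearMap.proj σ else 0) ?_ ?_ ?_
  · rintro a c hc
    obtain ⟨h1, h2⟩ := mem_exteriorPiece.1 hc
    funext σ
    simp only [LinearMap.pi_apply]
    split_ifs with hσ
    · exact gradedProj_of_mem h (h1 σ hσ)
    · exact (h2 σ hσ).symm
  · rintro a b hne c hc
    obtain ⟨h1, h2⟩ := mem_exteriorPiece.1 hc
    funext σ
    simp only [LinearMap.pi_apply]
    split_ifs with hσ
    · by_cases hσ' : (σ.card : ℤ) = b.1
      · exact gradedProj_of_mem_ne h (fun e => hne (Prod.ext (hσ.symm.trans hσ') e)) (h1 σ hσ')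
      · simp [h2 σ hσ']
    · rfl
  · rw [eq_top_iff]
    intro c _
    rw [← Finset.univ_sum_single c]
    refine Submodule.sum_mem _ fun σ _ => ?_
    have hm : c σ ∈ ⨆ d, ℳ d := h.submodule_iSup_eq_top ▸ Submodule.mem_top
    generalize c σ = m at hm
    induction hm using Submodule.iSup_induction' with
    | zero => simp
    | add a b _ _ ha hb => rw [Pi.single_add]; exact Submodule.add_mem _ ha hb
    | mem d m hm =>
      exact Submodule.mem_iSup_of_mem ((σ.card : ℤ), d) (single_mem_exteriorPiece hm)

/-- The identification of `k[x] ⊗ (⋀ V ⊗ M)` with `⋀ V ⊗ k[x] ⊗ M`. -/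
def koszulEquiv (n : ℕ) (k : Type*) [Field k] (M : Type*) [AddCommGroup M] [Module k M] :
    MvPolynomial (Fin n) k ⊗[k] (Finset (Fin n) → M) ≃ₗ[MvPolynomial (Fin n) k]
      KoszulModule n k M :=
  TensorProduct.piRight k (MvPolynomial (Fin n) k) (MvPolynomial (Fin n) k) fun _ => M

lemma koszulEquiv_tmul (f : MvPolynomial (Fin n) k) (c : Finset (Fin n) → M) :
    koszulEquiv n k M (f ⊗ₜ c) = fun σ => f ⊗ₜ c σ := rfl

lemma koszulEquiv_tmul_single (f : MvPolynomial (Fin n) k) (σ : Finset (Fin n)) (m : M) :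
    koszulEquiv n k M (f ⊗ₜ Pi.single σ m) = Pi.single σ (f ⊗ₜ m) := by
  rw [koszulEquiv_tmul]
  funext τ
  by_cases h : τ = σ
  · subst h; simp
  · simp [Pi.single_eq_of_ne h]

/-- The extension of scalars from `⋀ V ⊗ M` to `⋀ V ⊗ k[x] ⊗ M`. -/
def extendScalars : Module.End k (Finset (Fin n) → M) →+*
    Module.End (MvPolynomial (Fin n) k) (KoszulModule n k M) :=
  ((koszulEquiv n k M).conjRingEquiv.toRingHom).comp
    (Module.End.baseChangeHom k (MvPolynomial (Fin n) k) (Finset (Fin n) → M)).toRingHom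

lemma extendScalars_apply (g : Module.End k (Finset (Fin n) → M))
    (f : MvPolynomial (Fin n) k) (c : Finset (Fin n) → M) :
    extendScalars g (koszulEquiv n k M (f ⊗ₜ c)) = koszulEquiv n k M (f ⊗ₜ g c) := by
  change koszulEquiv n k M (g.baseChange _ ((koszulEquiv n k M).symm _)) = _
  rw [LinearEquiv.symm_apply_apply]; rfl

lemma koszul_hom_ext {Y : Type*} [AddCommGroup Y] [Module (MvPolynomial (Fin n) k) Y]
    {f g : KoszulModule n k M →ₗ[MvPolynomial (Fin n) k] Y}
    (h : ∀ r c, f (koszulEquiv n k M (r ⊗ₜ c)) = g (koszulEquiv n k M (r ⊗ₜ c))) : f = g := by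
  refine LinearMap.ext fun x => ?_
  obtain ⟨x, rfl⟩ := (koszulEquiv n k M).surjective x
  induction x with
  | zero => simp
  | add a b ha hb => simp only [map_add, ha, hb]
  | tmul r c => exact h r c

variable [Module (MvPolynomial (Fin n) k) M] [IsScalarTower k (MvPolynomial (Fin n) k) M]

/-- The operators `-x_j` on `M`. -/
def negAct (n : ℕ) (k : Type*) [Field k] (M : Type*) [AddCommGroup M] [Module k M]
    [Module (MvPolynomial (Fin n) k) M] [IsScalarTower k (MvPolynomial (Fin n) k) M] (j : Fin n) :
    M →ₗ[k] M := -(Algebra.lsmul k k M (MvPolynomial.X j : MvPolynomial (Fin n) k))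

lemma negAct_comm (j l : Fin n) : negAct n k M j ∘ₗ negAct n k M l =
    negAct n k M l ∘ₗ negAct n k M j := by
  ext; simp [negAct, smul_smul, mul_comm]

/-- The vertical differential acts on `M` alone and is therefore defined over `k`, so a splitting
over the field extends to one over the polynomial ring. -/
lemma extendScalars_koszulMap :
    extendScalars (koszulMap (negAct n k M)) = koszulMap (yAct n k M) := by
  refine koszul_hom_ext fun r c => ?_
  rw [extendScalars_apply]
  funext σ
  rw [koszulEquiv_tmul, koszulEquiv_tmul, koszulMap_apply]
  simp only [koszulMap_apply, TensorProduct.tmul_sum]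
  refine Finset.sum_congr rfl fun j _ => ?_
  rw [TensorProduct.tmul_smul]
  rfl

lemma koszulMap_negAct_mem {ℳ : ℤ → Submodule k M} (h : IsStandardGrading n ℳ) {i e : ℤ}
    {c : Finset (Fin n) → M} (hc : c ∈ exteriorPiece n ℳ (i, e)) :
    koszulMap (negAct n k M) c ∈ exteriorPiece n ℳ (i - 1, e + 1) := by
  obtain ⟨h1, h2⟩ := mem_exteriorPiece.1 hc
  refine mem_exteriorPiece.2 ⟨fun σ hσ => ?_, fun σ hσ => ?_⟩
  · rw [koszulMap_apply]
    refine Submodule.sum_mem _ fun j hj =>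
      zsmul_mem (Submodule.neg_mem _ (h.X_smul_mem j _ _ (h1 _ ?_))) _
    rw [Finset.card_insert_of_notMem (Finset.mem_compl.1 hj)]
    push_cast
    simp only at hσ
    omega
  · rw [koszulMap_apply]
    refine Finset.sum_eq_zero fun j hj => ?_
    rw [h2, map_zero, smul_zero]
    rw [Finset.card_insert_of_notMem (Finset.mem_compl.1 hj)]
    push_cast
    simp only at hσ ⊢
    omega

/-- There are a projection `P₁` of the Koszul bicomplex that represents the vertical homology
and is defined over the base field, and a homogeneous basis of its image. -/
lemma exists_homology_basis {k : Type v} [Field k] {M : Type u} [AddCommGroup M]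
    [Module k M] [Module (MvPolynomial (Fin n) k) M] [IsScalarTower k (MvPolynomial (Fin n) k) M]
    {ℳ : ℤ → Submodule k M} (hℳ : IsStandardGrading n ℳ) :
    ∃ (s₁ : Module.End (MvPolynomial (Fin n) k) (KoszulModule n k M))
      (p : Module.End k (Finset (Fin n) → M)) (J : Type u) (deg : J → ℤ × ℤ)
      (b : J → Finset (Fin n) → M),
      (∀ f c, (1 - koszulMap (yAct n k M) * s₁ - s₁ * koszulMap (yAct n k M) :
        Module.End (MvPolynomial (Fin n) k) (KoszulModule n k M))
          (koszulEquiv n k M (f ⊗ₜ c)) = koszulEquiv n k M (f ⊗ₜ p c)) ∧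
      koszulMap (yAct n k M) * s₁ * koszulMap (yAct n k M) = koszulMap (yAct n k M) ∧
      s₁ * s₁ = 0 ∧ s₁ * koszulMap (yAct n k M) * s₁ = s₁ ∧
      LinearIndependent k b ∧ (∀ j, b j ∈ exteriorPiece n ℳ (deg j)) ∧
      (∀ j, p (b j) = b j) ∧
      ∀ a, ∀ x ∈ exteriorPiece n ℳ a, p x ∈ Submodule.span k (b '' {j | deg j = a}) := by
  have hI := exteriorPiece_isInternal (n := n) hℳ.isInternal
  let φ : ℤ × ℤ ≃ ℤ × ℤ := (Equiv.addRight (-1)).prodCongr (Equiv.addRight 1)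
  set δ : Module.End k (Finset (Fin n) → M) := koszulMap (negAct n k M) with hδ
  have hδφ : ∀ a, ∀ x ∈ exteriorPiece n ℳ a, δ x ∈ exteriorPiece n ℳ (φ a) := by
    rintro ⟨i, e⟩ x hx
    exact koszulMap_negAct_mem hℳ hx
  have hδδ : δ ∘ₗ δ = 0 := koszulMap_koszulMap _ negAct_comm
  obtain ⟨s, hs, hss, hdsd, hsds⟩ := exists_graded_splitting hI φ hδφ hδδ
  -- The zero perturbation makes the identities for the homology projection available for the
  -- unperturbed splitting.
  have hdat : PerturbationData δ 0 s 1 :=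
    .of_splitting hδδ hss (by rw [mul_assoc]; exact hdsd) (by rw [mul_assoc]; exact hsds)
  have hp : ∀ a, ∀ x ∈ exteriorPiece n ℳ a,
      (1 - δ * s - s * δ : Module.End k (Finset (Fin n) → M)) x ∈ exteriorPiece n ℳ a := by
    intro a x hx
    have h1 := hδφ _ _ (hs a x hx)
    have h2 := hs _ _ (hδφ a x hx)
    rw [Equiv.apply_symm_apply] at h1
    rw [Equiv.symm_apply_apply] at h2
    exact Submodule.sub_mem _ (Submodule.sub_mem _ hx h1) h2
  obtain ⟨J, deg, b, hb1, hb2, hb3, hb4⟩ :=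
    exists_homogeneous_basis_range hI hp (LinearMap.congr_fun hdat.proj_proj)
  refine ⟨extendScalars s, _, J, deg, b, fun f c => ?_, ?_, ?_, ?_, hb1, hb2, hb3, hb4⟩
  · rw [← extendScalars_koszulMap, ← extendScalars_apply, map_sub, map_sub, map_mul, map_mul,
      map_one]
  · rw [← extendScalars_koszulMap, ← map_mul, ← map_mul, hdat.dsd]
  · rw [← map_mul, hdat.ss, map_zero]
  · rw [← extendScalars_koszulMap, ← map_mul, ← map_mul, hdat.sds]

end BaseField

/-! ## The perturbed Koszul bicomplex -/

section Koszul

variable {k : Type*} [Field k] {n : ℕ} {M : Type*} [AddCommGroup M] [Module k M]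
  {ℳ : ℤ → Submodule k M}

/-- The elements of exterior degree `i` in the Koszul bicomplex. -/
abbrev koszulExterior (n : ℕ) (k : Type*) [Field k] (M : Type*) [AddCommGroup M] [Module k M]
    (i : ℤ) : Submodule (MvPolynomial (Fin n) k) (KoszulModule n k M) :=
  exteriorDegree n (MvPolynomial (Fin n) k) (MvPolynomial (Fin n) k ⊗[k] M) i

/-- The projection to exterior degree `i` in the Koszul bicomplex. -/
abbrev koszulExteriorProj (n : ℕ) (k : Type*) [Field k] (M : Type*) [AddCommGroup M] [Module k M]
    (i : ℤ) : KoszulModule n k M →ₗ[MvPolynomial (Fin n) k] KoszulModule n k M :=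
  exteriorProj n (MvPolynomial (Fin n) k) (MvPolynomial (Fin n) k ⊗[k] M) i

lemma koszulExterior_induction (h : DirectSum.IsInternal ℳ) {i : ℤ}
    {Y : AddSubgroup (KoszulModule n k M)}
    (hY : ∀ (σ : Finset (Fin n)), (σ.card : ℤ) = i → ∀ (f : MvPolynomial (Fin n) k) (e : ℤ),
      ∀ m ∈ ℳ e, Pi.single σ (f ⊗ₜ m) ∈ Y) {c : KoszulModule n k M}
    (hc : c ∈ koszulExterior n k M i) : c ∈ Y := by
  rw [← Finset.univ_sum_single c]
  refine AddSubgroup.sum_mem _ fun σ _ => ?_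
  by_cases hσ : (σ.card : ℤ) = i
  · generalize c σ = x
    induction x with
    | zero => rw [Pi.single_zero]; exact Y.zero_mem
    | add a b ha hb => rw [Pi.single_add]; exact Y.add_mem ha hb
    | tmul f m =>
      have hm : m ∈ ⨆ d, ℳ d := h.submodule_iSup_eq_top ▸ Submodule.mem_top
      induction hm using Submodule.iSup_induction' with
      | zero => rw [TensorProduct.tmul_zero, Pi.single_zero]; exact Y.zero_mem
      | add a b _ _ ha hb =>
        rw [TensorProduct.tmul_add, Pi.single_add]; exact Y.add_mem ha hb
      | mem d m hm => exact hY σ hσ f d m hm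
  · rw [hc σ hσ, Pi.single_zero]
    exact Y.zero_mem

/-- The component of degree `t` mixes exterior degrees. After projection to exterior degree `i` only
generators with `|σ| = i` contribute. -/
lemma koszulDegree_induction {t i : ℤ} {Y : AddSubgroup (KoszulModule n k M)}
    (hY : ∀ (σ : Finset (Fin n)), (σ.card : ℤ) = i → ∀ (f : MvPolynomial (Fin n) k) (a : ℕ)
      (e : ℤ), f.IsHomogeneous a → i + a + e = t → ∀ m ∈ ℳ e, Pi.single σ (f ⊗ₜ m) ∈ Y)
    {c : KoszulModule n k M} (hc : c ∈ koszulDegree n ℳ t) :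
    koszulExteriorProj n k M i c ∈ Y := by
  have : koszulDegree n ℳ t ≤
      Y.comap (koszulExteriorProj n k M i : KoszulModule n k M →+ KoszulModule n k M) := by
    refine (AddSubgroup.closure_le _).2 ?_
    rintro _ ⟨σ, a, e, f, m, hf, hm, ht, rfl⟩
    change koszulExteriorProj n k M i (Pi.single σ (f ⊗ₜ m)) ∈ Y
    by_cases hσ : (σ.card : ℤ) = i
    · rw [exteriorProj_of_mem]
      · exact hY σ hσ f a e hf (hσ ▸ ht) m hm
      · refine fun τ hτ => Pi.single_eq_of_ne ?_ _
        rintro rfl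
        exact hτ hσ
    · have : koszulExteriorProj n k M i (Pi.single σ (f ⊗ₜ m)) = 0 := by
        funext τ
        rw [exteriorProj_apply]
        split_ifs with hτ
        · refine Pi.single_eq_of_ne ?_ _
          rintro rfl
          exact hσ hτ
        · rfl
      rw [this]
      exact Y.zero_mem
  exact this hc

lemma koszulPiece_le_koszulExterior (p q : ℤ) :
    koszulPiece n ℳ p q ≤ koszulExterior n k M (p + q) := fun _ hc => (mem_koszulPiece.1 hc).2

lemma koszulExterior_le_iSup (h : DirectSum.IsInternal ℳ) (i : ℤ) :
    koszulExterior n k M i ≤ ⨆ p : ℤ, koszulPiece n ℳ p (i - p) := by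
  intro c hc
  refine koszulExterior_induction h (Y := (⨆ p : ℤ, koszulPiece n ℳ p (i - p)).toAddSubgroup)
    (fun σ hσ f e m hm => ?_) hc
  -- For `m` of degree `e` the indices are `q = -e` and `p = i - q = i + e`.
  refine Submodule.mem_iSup_of_mem (i + e) (mem_koszulPiece.2 ⟨fun τ _ => ?_, fun τ hτ => ?_⟩)
  · rw [show -(i - (i + e)) = e by ring]
    by_cases hτσ : τ = σ
    · subst hτσ
      rw [Pi.single_eq_same]
      exact Submodule.tmul_mem_baseChange_of_mem f hm
    · rw [Pi.single_eq_of_ne hτσ]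
      exact Submodule.zero_mem _
  · refine Pi.single_eq_of_ne ?_ _
    rintro rfl
    exact hτ (by rw [hσ]; ring)

lemma koszulPiece_eq_bot {d₀ : ℤ} (hd₀ : ∀ d < d₀, ℳ d = ⊥) {p q : ℤ} (hq : -q < d₀) :
    koszulPiece n ℳ p q = ⊥ := by
  rw [eq_bot_iff]
  intro c hc
  obtain ⟨h1, h2⟩ := mem_koszulPiece.1 hc
  rw [Submodule.mem_bot]
  funext σ
  by_cases hσ : (σ.card : ℤ) = p + q
  · have := h1 σ hσ
    rw [hd₀ _ hq, Submodule.baseChange_bot] at this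
    exact this
  · exact h2 σ hσ

variable [Module (MvPolynomial (Fin n) k) M] [IsScalarTower k (MvPolynomial (Fin n) k) M]
  {hℳ : IsStandardGrading n ℳ}

/-- The sign of `d` is reversed in the total differential so that the perturbation series is `∑ (d₁
d⁺)^j` without alternating signs, as in the `ω_j`. -/
lemma koszulMap_diagAct_eq :
    koszulMap (diagAct n k M) = (koszulBicomplex ℳ hℳ).d₁ - (koszulBicomplex ℳ hℳ).d := by
  refine LinearMap.ext fun c => funext fun σ => ?_
  change koszulMap (diagAct n k M) c σ = koszulMap (xAct n k M) c σ - koszulMap (yAct n k M) c σ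
  simp only [koszulMap_apply, diagAct, LinearMap.sub_apply, smul_sub, Finset.sum_sub_distrib]

variable (S : VerticalSplitting (koszulBicomplex ℳ hℳ))

namespace VerticalSplitting

lemma dplus_mem_koszulExterior {i : ℤ} {c : KoszulModule n k M}
    (hc : c ∈ koszulExterior n k M i) : S.dplus c ∈ koszulExterior n k M (i + 1) := by
  have : ⨆ p : ℤ, koszulPiece n ℳ p (i - p) ≤ (koszulExterior n k M (i + 1)).comap S.dplus := by
    refine iSup_le fun p x hx => ?_
    have := koszulPiece_le_koszulExterior _ _ (S.dplus_mem p (i - p) x hx)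
    rwa [show p + (i - p + 1) = i + 1 by ring] at this
  exact this (koszulExterior_le_iSup hℳ.isInternal i hc)

lemma P_mem_koszulExterior {i : ℤ} {c : KoszulModule n k M}
    (hc : c ∈ koszulExterior n k M i) : S.P c ∈ koszulExterior n k M i := by
  have h1 := koszulMap_mem_exteriorDegree (yAct n k M) (S.dplus_mem_koszulExterior hc)
  have hc' : c ∈ koszulExterior n k M (i - 1 + 1) := by rwa [sub_add_cancel]
  have h2 := S.dplus_mem_koszulExterior (koszulMap_mem_exteriorDegree (yAct n k M) hc')
  rw [sub_add_cancel] at h2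
  exact Submodule.sub_mem _ (Submodule.sub_mem _ hc h1) h2

lemma pow_mem_koszulPiece (j : ℕ) {p q : ℤ} {c : KoszulModule n k M}
    (hc : c ∈ koszulPiece n ℳ p q) :
    (((koszulBicomplex ℳ hℳ).d₁ ∘ₗ S.dplus) ^ j) c ∈ koszulPiece n ℳ (p - j) (q + j) := by
  induction j with
  | zero => simpa
  | succ j ih =>
    rw [pow_succ', Module.End.mul_apply]
    have := (koszulBicomplex ℳ hℳ).d₁_mem _ _ _ (S.dplus_mem _ _ _ ih)
    rw [show p - j - 1 = p - (j + 1 : ℕ) by push_cast; ring,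
      show q + j + 1 = q + (j + 1 : ℕ) by push_cast; ring] at this
    exact this

/-- Each application of `d₁ d⁺` raises `q` by one, hence lowers the degree `-q` of the factor from
`M`, until it falls below `d₀`. -/
lemma locally_nilpotent (hbelow : ∃ d₀ : ℤ, ∀ d < d₀, ℳ d = ⊥) (c : KoszulModule n k M) :
    ∃ j : ℕ, (((koszulBicomplex ℳ hℳ).d₁ ∘ₗ S.dplus) ^ j) c = 0 := by
  obtain ⟨d₀, hd₀⟩ := hbelow
  have hc : c ∈ ⨆ a : ℤ × ℤ, koszulPiece n ℳ a.1 a.2 :=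
    (koszulPiece_isInternal (n := n) hℳ.isInternal).submodule_iSup_eq_top ▸ Submodule.mem_top
  induction hc using Submodule.iSup_induction' with
  | zero => exact ⟨0, by simp⟩
  | mem a c hc =>
    -- Large enough for `-(a.2 + j) < d₀`. If the number is negative, the piece itself is zero and
    -- `j = 0` suffices.
    refine ⟨(-d₀ - a.2 + 1).toNat, ?_⟩
    have h := S.pow_mem_koszulPiece (-d₀ - a.2 + 1).toNat hc
    rw [koszulPiece_eq_bot hd₀ (by omega)] at h
    exact h
  | add a b _ _ ha hb =>
    obtain ⟨j, hj⟩ := ha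
    obtain ⟨l, hl⟩ := hb
    refine ⟨max j l, ?_⟩
    rw [map_add, pow_apply_eq_zero_of_le (le_max_left j l) hj,
      pow_apply_eq_zero_of_le (le_max_right j l) hl, add_zero]

/-- The inverse of `1 - d₁ d⁺`. -/
def series (hbelow : ∃ d₀ : ℤ, ∀ d < d₀, ℳ d = ⊥) :
    Module.End (MvPolynomial (Fin n) k) (KoszulModule n k M) :=
  geomSeries ((koszulBicomplex ℳ hℳ).d₁ ∘ₗ S.dplus) (S.locally_nilpotent hbelow)

lemma perturbationData (hbelow : ∃ d₀ : ℤ, ∀ d < d₀, ℳ d = ⊥) :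
    PerturbationData (A := Module.End (MvPolynomial (Fin n) k) (KoszulModule n k M))
      (koszulBicomplex ℳ hℳ).d (koszulBicomplex ℳ hℳ).d₁ S.dplus (S.series hbelow) where
  dd := (koszulBicomplex ℳ hℳ).d_d
  ee := (koszulBicomplex ℳ hℳ).d₁_d₁
  de := eq_neg_of_add_eq_zero_left (koszulBicomplex ℳ hℳ).d_d₁
  ss := S.dplus_dplus
  dsd := by rw [mul_assoc]; exact S.d_dplus_d
  sds := by rw [mul_assoc]; exact S.dplus_d_dplus
  left_inv := geomSeries_mul_sub _
  right_inv := sub_mul_geomSeries _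

lemma P_eq : S.P = (1 - (koszulBicomplex ℳ hℳ).d * S.dplus - S.dplus * (koszulBicomplex ℳ hℳ).d :
    Module.End (MvPolynomial (Fin n) k) (KoszulModule n k M)) := rfl

lemma series_mem (hbelow : ∃ d₀ : ℤ, ∀ d < d₀, ℳ d = ⊥) {i : ℤ} {c : KoszulModule n k M}
    (hc : c ∈ koszulExterior n k M i) : S.series hbelow c ∈ koszulExterior n k M i :=
  geomSeries_mem _ (E := (koszulExterior n k M i).toAddSubgroup) (fun x hx =>
    koszulMap_mem_exteriorDegree (c := S.dplus x) (xAct n k M) (S.dplus_mem_koszulExterior hx)) hc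

/-! ## The total complex of the derived Wall complex -/

/-- As `K_{pq}` sits in exterior degree `p + q`, the homological degree of the total complex is the
exterior degree. -/
lemma mem_derivedWall_total {i : ℤ} {w : S.splitHomology} :
    w ∈ S.derivedWall.total i ↔ (w : KoszulModule n k M) ∈ koszulExterior n k M i := by
  constructor
  · intro hw
    have : S.derivedWall.total i ≤ (koszulExterior n k M i).comap S.splitHomology.subtype := by
      refine iSup_le fun p x hx => ?_
      have := koszulPiece_le_koszulExterior (k := k) (M := M) p (i - p) hx
      rwa [add_sub_cancel] at this
    exact this hw
  · intro hw
    have : ⨆ p : ℤ, koszulPiece n ℳ p (i - p) ≤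
        (S.derivedWall.total i).comap S.P.rangeRestrict := by
      refine iSup_le fun p x hx => ?_
      exact Submodule.mem_iSup_of_mem (p := fun p => S.derivedWall.deg p (i - p)) p (S.P_mem hx)
    have h := this (koszulExterior_le_iSup hℳ.isInternal i hw)
    have e : S.P.rangeRestrict w = w := Subtype.ext (S.P_of_mem w)
    rwa [Submodule.mem_comap, e] at h

/-- The projection to the `i`-th module of the total complex. -/
def projTotal (i : ℤ) :
    KoszulModule n k M →ₗ[MvPolynomial (Fin n) k] S.derivedWall.total i :=
  (S.P.rangeRestrict ∘ₗ koszulExteriorProj n k M i).codRestrict _ fun c =>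
    S.mem_derivedWall_total.2 (S.P_mem_koszulExterior (exteriorProj_mem i c))

lemma coe_projTotal {i : ℤ} {c : KoszulModule n k M} (hc : c ∈ koszulExterior n k M i) :
    ((S.projTotal i c : S.splitHomology) : KoszulModule n k M) = S.P c := by
  change S.P (koszulExteriorProj n k M i c) = _
  rw [exteriorProj_of_mem hc]

lemma total_mem {i : ℤ} (w : S.derivedWall.total i) :
    ((w : S.splitHomology) : KoszulModule n k M) ∈ koszulExterior n k M i :=
  S.mem_derivedWall_total.1 w.2

lemma total_ext {i : ℤ} {w w' : S.derivedWall.total i}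
    (h : ((w : S.splitHomology) : KoszulModule n k M) = (w' : S.splitHomology)) : w = w' :=
  Subtype.ext (Subtype.ext h)

lemma derivedWall_ω_succ (j : ℕ) (w : S.splitHomology) :
    ((S.derivedWall.ω (j + 1) w : S.splitHomology) : KoszulModule n k M) =
      S.P ((((koszulBicomplex ℳ hℳ).d₁ ∘ₗ S.dplus) ^ j) ((koszulBicomplex ℳ hℳ).d₁ w)) := rfl

lemma derivedWall_finite (hbelow : ∃ d₀ : ℤ, ∀ d < d₀, ℳ d = ⊥) (w : S.splitHomology) :
    ∃ l : ℕ, (((koszulBicomplex ℳ hℳ).d₁ ∘ₗ S.dplus) ^ l) ((koszulBicomplex ℳ hℳ).d₁ w) = 0 ∧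
      ∀ j, l < j → S.derivedWall.ω j w = 0 := by
  obtain ⟨l, hl⟩ := S.locally_nilpotent hbelow ((koszulBicomplex ℳ hℳ).d₁ w)
  refine ⟨l, hl, fun j hj => ?_⟩
  obtain ⟨j, rfl⟩ : ∃ j', j = j' + 1 := ⟨j - 1, by omega⟩
  refine Subtype.ext ?_
  rw [derivedWall_ω_succ, pow_apply_eq_zero_of_le (by omega) hl, map_zero]
  rfl

lemma derivedWall_locallyFinite (hbelow : ∃ d₀ : ℤ, ∀ d < d₀, ℳ d = ⊥) :
    S.derivedWall.LocallyFinite := by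
  intro p q w _
  obtain ⟨l, _, hl⟩ := S.derivedWall_finite hbelow w
  refine (Set.finite_Iic l).subset fun j hj => ?_
  by_contra hlj
  exact hj (hl j (not_le.1 hlj))

/-- The map `ω_{j+1}` is the `j`-th term of the geometric series between `P` and `d₁`, and `ω_0 = 0`
absorbs the shift. This puts `D` in the form `P u d₁` of the perturbation lemma. -/
lemma derivedWall_D (hbelow : ∃ d₀ : ℤ, ∀ d < d₀, ℳ d = ⊥) (h : S.derivedWall.LocallyFinite)
    (w : S.splitHomology) :
    ((S.derivedWall.D h w : S.splitHomology) : KoszulModule n k M) =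
      S.P (S.series hbelow ((koszulBicomplex ℳ hℳ).d₁ w)) := by
  obtain ⟨l, hl0, hl⟩ := S.derivedWall_finite hbelow w
  have h1 : S.derivedWall.D h w = ∑ j ∈ Finset.range (l + 1), S.derivedWall.ω j w := by
    refine finsum_eq_sum_of_support_subset _ fun j hj => ?_
    rw [Finset.coe_range, Set.mem_Iio]
    by_contra hlj
    exact hj (hl j (by omega))
  have h0 : S.derivedWall.ω 0 w = 0 := rfl
  rw [h1, Finset.sum_range_succ', h0, add_zero, series, geomSeries_apply, finsum_pow_eq_sum hl0,
    map_sum, AddSubmonoidClass.coe_finsetSum]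
  rfl

/-- For `D² = 0`, `projection_comm` is applied to `d₁ w`: this is a cycle for `d₁ - d`, because `d₁²
= 0` and `d d₁ w = -d₁ d w = 0` for `w` in the split homology. -/
lemma derivedWall_isWallComplex (hbelow : ∃ d₀ : ℤ, ∀ d < d₀, ℳ d = ⊥) :
    S.derivedWall.IsWallComplex where
  locallyFinite := S.derivedWall_locallyFinite hbelow
  D_sq := by
    refine LinearMap.ext fun w => Subtype.ext ?_
    rw [LinearMap.comp_apply, S.derivedWall_D hbelow, S.derivedWall_D hbelow]
    have hd := S.perturbationData hbelow
    have hc := LinearMap.congr_fun hd.projection_comm ((koszulBicomplex ℳ hℳ).d₁ w)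
    have e1 : (koszulBicomplex ℳ hℳ).d₁ ((koszulBicomplex ℳ hℳ).d₁ w) = 0 :=
      LinearMap.congr_fun hd.ee _
    have e2 : (koszulBicomplex ℳ hℳ).d w = 0 := by
      rw [← S.P_of_mem w]; exact LinearMap.congr_fun hd.d_proj _
    have e3 : (koszulBicomplex ℳ hℳ).d ((koszulBicomplex ℳ hℳ).d₁ w) = 0 := by
      have := LinearMap.congr_fun hd.de w
      simp only [Module.End.mul_apply, LinearMap.neg_apply, e2, map_zero, neg_zero] at this
      exact this
    rw [← P_eq] at hc
    simp only [Module.End.mul_apply, LinearMap.sub_apply, e1, e3, sub_zero, map_zero] at hc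
    exact hc.symm

lemma coe_totalDiff (hbelow : ∃ d₀ : ℤ, ∀ d < d₀, ℳ d = ⊥) (h : S.derivedWall.LocallyFinite)
    {i : ℤ} (w : S.derivedWall.total (i + 1)) :
    ((S.derivedWall.totalDiff h i w : S.splitHomology) : KoszulModule n k M) =
      S.P (S.series hbelow ((koszulBicomplex ℳ hℳ).d₁ (w : S.splitHomology))) :=
  S.derivedWall_D hbelow h w

/-- The comparison map from the derived Wall complex to the total complex of the bicomplex. -/
def inclusion (hbelow : ∃ d₀ : ℤ, ∀ d < d₀, ℳ d = ⊥) :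
    S.splitHomology →ₗ[MvPolynomial (Fin n) k] KoszulModule n k M :=
  (1 + S.dplus * S.series hbelow * (koszulBicomplex ℳ hℳ).d₁ :
    Module.End (MvPolynomial (Fin n) k) (KoszulModule n k M)) ∘ₗ S.splitHomology.subtype

lemma inclusion_apply (hbelow : ∃ d₀ : ℤ, ∀ d < d₀, ℳ d = ⊥) (w : S.splitHomology) :
    S.inclusion hbelow w = w + S.dplus (S.series hbelow ((koszulBicomplex ℳ hℳ).d₁ w)) := rfl

lemma inclusion_mem (hbelow : ∃ d₀ : ℤ, ∀ d < d₀, ℳ d = ⊥) {i : ℤ} (w : S.derivedWall.total i) :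
    S.inclusion hbelow w ∈ koszulExterior n k M i := by
  rw [inclusion_apply]
  refine Submodule.add_mem _ (S.total_mem w) ?_
  have hw : ((w : S.splitHomology) : KoszulModule n k M) ∈ koszulExterior n k M (i - 1 + 1) := by
    rw [sub_add_cancel]; exact S.total_mem w
  have := S.dplus_mem_koszulExterior (S.series_mem hbelow
    (koszulMap_mem_exteriorDegree (xAct n k M) hw))
  rw [sub_add_cancel] at this
  exact this

lemma koszulMap_inclusion (hbelow : ∃ d₀ : ℤ, ∀ d < d₀, ℳ d = ⊥)
    (h : S.derivedWall.LocallyFinite) (w : S.splitHomology) :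
    koszulMap (diagAct n k M) (S.inclusion hbelow w) =
      S.inclusion hbelow (S.derivedWall.D h w) := by
  have hc := LinearMap.congr_fun (S.perturbationData hbelow).inclusion_comm w
  rw [← P_eq] at hc
  simp only [Module.End.mul_apply, S.P_of_mem] at hc
  rw [koszulMap_diagAct_eq (hℳ := hℳ), inclusion, LinearMap.comp_apply, LinearMap.comp_apply,
    Submodule.subtype_apply, Submodule.subtype_apply, S.derivedWall_D hbelow]
  exact hc

lemma P_series_inclusion (hbelow : ∃ d₀ : ℤ, ∀ d < d₀, ℳ d = ⊥) (w : S.splitHomology) :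
    S.P (S.series hbelow (S.inclusion hbelow w)) = w := by
  have hc := LinearMap.congr_fun (S.perturbationData hbelow).projection_inclusion w
  rw [← P_eq] at hc
  simp only [Module.End.mul_apply, S.P_of_mem] at hc
  exact hc

lemma totalDiff_projTotal_series (hbelow : ∃ d₀ : ℤ, ∀ d < d₀, ℳ d = ⊥)
    (h : S.derivedWall.LocallyFinite) {i : ℤ} {y : KoszulModule n k M}
    (hy : y ∈ koszulExterior n k M (i + 1)) :
    ((S.derivedWall.totalDiff h i (S.projTotal (i + 1) (S.series hbelow y)) : S.splitHomology) :
      KoszulModule n k M) = S.P (S.series hbelow (koszulMap (diagAct n k M) y)) := by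
  have hc := LinearMap.congr_fun (S.perturbationData hbelow).projection_comm y
  rw [← P_eq] at hc
  rw [S.coe_totalDiff hbelow, S.coe_projTotal (S.series_mem hbelow hy),
    koszulMap_diagAct_eq (hℳ := hℳ)]
  exact hc.symm

/-- The augmentation of the derived Wall complex. -/
def derivedAugment (hbelow : ∃ d₀ : ℤ, ∀ d < d₀, ℳ d = ⊥) :
    S.derivedWall.total 0 →ₗ[MvPolynomial (Fin n) k] M :=
  koszulAugment hℳ ∘ₗ S.inclusion hbelow ∘ₗ (S.derivedWall.total 0).subtype

lemma derivedAugment_apply (hbelow : ∃ d₀ : ℤ, ∀ d < d₀, ℳ d = ⊥) (w : S.derivedWall.total 0) :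
    S.derivedAugment hbelow w = koszulAugment hℳ (S.inclusion hbelow w) := rfl

lemma derivedAugment_surjective (hbelow : ∃ d₀ : ℤ, ∀ d < d₀, ℳ d = ⊥) :
    Function.Surjective (S.derivedAugment hbelow) := by
  intro m
  obtain ⟨c, hc, rfl⟩ := koszulAugment_surjective hℳ m
  refine ⟨S.projTotal 0 (S.series hbelow c), ?_⟩
  have hd := S.perturbationData hbelow
  have h1 := LinearMap.congr_fun hd.inclusion_projection c
  have h2 : koszulMap (diagAct n k M) c = 0 := by
    funext σ
    rw [koszulMap_apply]
    refine Finset.sum_eq_zero fun j _ => ?_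
    rw [hc (insert j σ), map_zero, smul_zero]
    have := Finset.card_pos.2 ⟨j, Finset.mem_insert_self j σ⟩
    omega
  rw [koszulMap_diagAct_eq (hℳ := hℳ)] at h2
  -- Every `c` of exterior degree `0` is a cycle, so projecting and including changes it by a
  -- boundary only, which the augmentation does not see.
  have h3 : S.inclusion hbelow (S.projTotal 0 (S.series hbelow c)) =
      c + koszulMap (diagAct n k M) (S.dplus (S.series hbelow c)) := by
    rw [inclusion, LinearMap.comp_apply, Submodule.subtype_apply,
      S.coe_projTotal (S.series_mem hbelow hc), koszulMap_diagAct_eq (hℳ := hℳ)]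
    refine h1.trans ?_
    simp only [LinearMap.add_apply, Module.End.mul_apply, h2, map_zero, add_zero]
    rfl
  rw [derivedAugment_apply, h3, map_add, koszulAugment_koszulMap, add_zero]

/-- Include `w` into the total complex, write it there as a boundary of `y`, and project `y` back by
`P u`. As `P u` is a chain map and inverts the inclusion on `H`, the result has differential `w`.
The same argument gives `derivedWall_exact`. -/
lemma derivedAugment_exact (hbelow : ∃ d₀ : ℤ, ∀ d < d₀, ℳ d = ⊥)
    (h : S.derivedWall.LocallyFinite) :
    Function.Exact (S.derivedWall.totalDiff h 0) (S.derivedAugment hbelow) := by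
  intro w
  constructor
  · intro hw
    obtain ⟨y, hy, e⟩ := koszulAugment_exact hℳ (S.inclusion_mem hbelow w) hw
    refine ⟨S.projTotal (0 + 1) (S.series hbelow y), S.total_ext ?_⟩
    rw [S.totalDiff_projTotal_series hbelow h (by simpa using hy), e, S.P_series_inclusion]
  · rintro ⟨y, rfl⟩
    have e : S.inclusion hbelow (S.derivedWall.totalDiff h 0 y) =
      koszulMap (diagAct n k M) (S.inclusion hbelow y) :=
      (S.koszulMap_inclusion hbelow h y).symm
    rw [derivedAugment_apply, e, koszulAugment_koszulMap]

lemma derivedWall_exact (hbelow : ∃ d₀ : ℤ, ∀ d < d₀, ℳ d = ⊥)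
    (h : S.derivedWall.IsWallComplex) {i : ℤ} (hi : 0 ≤ i) :
    Function.Exact (S.derivedWall.totalDiff h.locallyFinite (i + 1))
      (S.derivedWall.totalDiff h.locallyFinite i) := by
  intro w
  constructor
  · intro hw
    have e : S.derivedWall.D h.locallyFinite w = 0 := congrArg Subtype.val hw
    have h0 : koszulMap (diagAct n k M) (S.inclusion hbelow w) = 0 := by
      rw [S.koszulMap_inclusion hbelow h.locallyFinite, e, map_zero]
    obtain ⟨y, hy, e⟩ := koszulMap_diagAct_exact (by omega) (S.inclusion_mem hbelow w) h0
    refine ⟨S.projTotal (i + 1 + 1) (S.series hbelow y), S.total_ext ?_⟩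
    rw [S.totalDiff_projTotal_series hbelow h.locallyFinite hy, e, S.P_series_inclusion]
  · rintro ⟨y, rfl⟩
    exact Subtype.ext (LinearMap.congr_fun h.D_sq y)

lemma derivedWall_subsingleton {i : ℤ} (hi : i < 0) : Subsingleton (S.derivedWall.total i) := by
  refine ⟨fun a b => S.total_ext (funext fun σ => ?_)⟩
  rw [S.total_mem a σ (by omega), S.total_mem b σ (by omega)]

/-- To land in `𝔪 W_i`, and not merely in `W_i ∩ 𝔪 K`, the differential is written as a
`k[x]`-linear map `K → W_i` applied to `d₁ w ∈ 𝔪 K`. -/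
lemma derivedWall_minimal (hbelow : ∃ d₀ : ℤ, ∀ d < d₀, ℳ d = ⊥)
    (h : S.derivedWall.LocallyFinite) (i : ℤ) (w : S.derivedWall.total (i + 1)) :
    S.derivedWall.totalDiff h i w ∈
      Ideal.span (Set.range (MvPolynomial.X : Fin n → MvPolynomial (Fin n) k)) •
        (⊤ : Submodule (MvPolynomial (Fin n) k) (S.derivedWall.total i)) := by
  have hw := koszulMap_mem_exteriorDegree (xAct n k M) (S.total_mem w)
  have e : S.derivedWall.totalDiff h i w =
      (S.projTotal i ∘ₗ S.series hbelow) (koszulMap (xAct n k M) (w : S.splitHomology)) := by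
    refine S.total_ext ?_
    rw [S.coe_totalDiff hbelow, LinearMap.comp_apply, S.coe_projTotal (S.series_mem hbelow hw)]
    rfl
  have h1 : koszulMap (xAct n k M) ((w : S.splitHomology) : KoszulModule n k M) ∈
      Ideal.span (Set.range (MvPolynomial.X : Fin n → MvPolynomial (Fin n) k)) •
        (⊤ : Submodule (MvPolynomial (Fin n) k) (KoszulModule n k M)) := by
    generalize ((w : S.splitHomology) : KoszulModule n k M) = c
    rw [← Finset.univ_sum_single c, map_sum]
    refine Submodule.sum_mem _ fun τ _ => ?_
    rw [koszulMap_single]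
    refine Submodule.sum_mem _ fun j _ => zsmul_mem ?_ _
    rw [xAct, LinearMap.lsmul_apply, Pi.single_smul]
    exact Submodule.smul_mem_smul (Ideal.subset_span ⟨j, rfl⟩) trivial
  have h2 := Submodule.mem_map_of_mem (f := S.projTotal i ∘ₗ S.series hbelow) h1
  rw [Submodule.map_smul''] at h2
  rw [e]
  exact Submodule.smul_mono le_rfl le_top h2

end VerticalSplitting

end Koszul

/-! ### Homogeneous bases and gradings of the derived Wall complex -/

lemma isGradedFree_of_basis {k : Type*} [Field k] {n : ℕ} {F : Type*} [AddCommGroup F]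
    [Module (MvPolynomial (Fin n) k) F] {G : ℤ → AddSubgroup F} {J : Type*}
    (b : Module.Basis J (MvPolynomial (Fin n) k) F) (δ : J → ℤ)
    (h : ∀ t, G t = AddSubgroup.closure {x | ∃ (j : J) (a : ℕ) (f : MvPolynomial (Fin n) k),
      f.IsHomogeneous a ∧ a + δ j = t ∧ x = f • b j}) : IsGradedFree (k := k) (n := n) G := by
  choose g hb using fun y : Set.range b => y.2
  refine ⟨Set.range b, b.reindexRange, fun y => δ (g y), fun t => ?_⟩
  rw [h t]
  congr 1
  ext x
  constructor
  · rintro ⟨j, a, f, hf, ht, rfl⟩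
    refine ⟨⟨b j, j, rfl⟩, a, f, hf, ?_, by rw [Module.Basis.reindexRange_self]⟩
    have hj : g ⟨b j, j, rfl⟩ = j := b.injective (hb ⟨b j, j, rfl⟩)
    simp only [hj, ht]
  · rintro ⟨y, a, f, hf, ht, rfl⟩
    refine ⟨g y, a, f, hf, ht, ?_⟩
    rw [Module.Basis.reindexRange_apply, hb]

/-- Over a polynomial ring, instance search does not find this instance. -/
@[reducible]
def totalAddCommGroup {R : Type*} [Ring R] {W : Type*} [AddCommGroup W] [Module R W]
    (A : WallArray R W) (i : ℤ) : AddCommGroup (A.total i) :=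
  Submodule.addCommGroup (A.total i)

section Koszul

attribute [local instance] totalAddCommGroup

variable {k : Type v} [Field k] {n : ℕ} {M : Type u} [AddCommGroup M] [Module k M]
  {ℳ : ℤ → Submodule k M}

lemma koszulEquiv_mem_koszulExterior {i e : ℤ} (f : MvPolynomial (Fin n) k)
    {l : Finset (Fin n) → M} (hl : l ∈ exteriorPiece n ℳ (i, e)) :
    koszulEquiv n k M (f ⊗ₜ l) ∈ koszulExterior n k M i := by
  intro σ hσ
  change f ⊗ₜ l σ = 0
  rw [(mem_exteriorPiece.1 hl).2 σ hσ, TensorProduct.tmul_zero]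

lemma koszulEquiv_mem_koszulDegree {i e : ℤ} {a : ℕ} {f : MvPolynomial (Fin n) k}
    (hf : f.IsHomogeneous a) {l : Finset (Fin n) → M} (hl : l ∈ exteriorPiece n ℳ (i, e)) :
    koszulEquiv n k M (f ⊗ₜ l) ∈ koszulDegree n ℳ (i + a + e) := by
  rw [← Finset.univ_sum_single (koszulEquiv n k M (f ⊗ₜ l))]
  refine AddSubgroup.sum_mem _ fun σ _ => ?_
  change Pi.single σ (f ⊗ₜ l σ) ∈ koszulDegree n ℳ _
  by_cases hσ : (σ.card : ℤ) = i
  · exact AddSubgroup.subset_closure ⟨σ, a, e, f, l σ, hf, (mem_exteriorPiece.1 hl).1 σ hσ,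
      by rw [hσ], rfl⟩
  · rw [(mem_exteriorPiece.1 hl).2 σ hσ, TensorProduct.tmul_zero, Pi.single_zero]
    exact AddSubgroup.zero_mem _

/-- Losing `z_j` costs one degree, which `T j` returns either in the polynomial factor (for `d₁`) or
in `M` (for `d`); the hypothesis covers both. -/
lemma koszulMap_mem_koszulDegree {T : Fin n → MvPolynomial (Fin n) k ⊗[k] M
      →ₗ[MvPolynomial (Fin n) k] MvPolynomial (Fin n) k ⊗[k] M}
    (hT : ∀ j (a : ℕ) (e : ℤ) (f : MvPolynomial (Fin n) k), ∀ m ∈ ℳ e, f.IsHomogeneous a →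
      ∃ (a' : ℕ) (e' : ℤ) (f' : MvPolynomial (Fin n) k) (m' : M), f'.IsHomogeneous a' ∧
        m' ∈ ℳ e' ∧ a' + e' = a + e + 1 ∧ T j (f ⊗ₜ m) = f' ⊗ₜ m') {t : ℤ}
    {c : KoszulModule n k M} (hc : c ∈ koszulDegree n ℳ t) :
    koszulMap T c ∈ koszulDegree n ℳ t := by
  have : koszulDegree n ℳ t ≤ (koszulDegree n ℳ t).comap
      (koszulMap T : KoszulModule n k M →+ KoszulModule n k M) := by
    refine (AddSubgroup.closure_le _).2 ?_
    rintro _ ⟨σ, a, e, f, m, hf, hm, ht, rfl⟩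
    change koszulMap T (Pi.single σ (f ⊗ₜ m)) ∈ koszulDegree n ℳ t
    rw [koszulMap_single]
    refine AddSubgroup.sum_mem _ fun j hj => zsmul_mem (AddSubgroup.subset_closure ?_) _
    obtain ⟨a', e', f', m', hf', hm', h, h'⟩ := hT j a e f m hm hf
    refine ⟨σ.erase j, a', e', f', m', hf', hm', ?_, by rw [h']⟩
    have := Finset.card_erase_add_one hj
    omega
  exact this hc

variable [Module (MvPolynomial (Fin n) k) M] [IsScalarTower k (MvPolynomial (Fin n) k) M]
  {hℳ : IsStandardGrading n ℳ}

lemma d_mem_koszulDegree {t : ℤ} {c : KoszulModule n k M} (hc : c ∈ koszulDegree n ℳ t) :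
    (koszulBicomplex ℳ hℳ).d c ∈ koszulDegree n ℳ t :=
  koszulMap_mem_koszulDegree (T := yAct n k M) (fun j a e f m hm hf =>
    ⟨a, e + 1, f, _, hf, Submodule.neg_mem _ (hℳ.X_smul_mem j e m hm), by ring, rfl⟩) hc

lemma d₁_mem_koszulDegree {t : ℤ} {c : KoszulModule n k M} (hc : c ∈ koszulDegree n ℳ t) :
    (koszulBicomplex ℳ hℳ).d₁ c ∈ koszulDegree n ℳ t :=
  koszulMap_mem_koszulDegree (T := xAct n k M) (fun j a e f m hm hf =>
    ⟨1 + a, e, _, m, (MvPolynomial.isHomogeneous_X k j).mul hf, hm, by push_cast; ring, rfl⟩) hc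

namespace VerticalSplitting

variable {S : VerticalSplitting (koszulBicomplex ℳ hℳ)}

lemma P_mem_koszulDegree (hS : IsHomogeneousSplitting S) {t : ℤ} {c : KoszulModule n k M}
    (hc : c ∈ koszulDegree n ℳ t) : S.P c ∈ koszulDegree n ℳ t :=
  AddSubgroup.sub_mem _ (AddSubgroup.sub_mem _ hc (d_mem_koszulDegree (hℳ := hℳ) (hS t c hc)))
    (hS t _ (d_mem_koszulDegree (hℳ := hℳ) hc))

lemma series_mem_koszulDegree (hS : IsHomogeneousSplitting S)
    (hbelow : ∃ d₀ : ℤ, ∀ d < d₀, ℳ d = ⊥) {t : ℤ} {c : KoszulModule n k M}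
    (hc : c ∈ koszulDegree n ℳ t) : S.series hbelow c ∈ koszulDegree n ℳ t :=
  geomSeries_mem _ (fun x hx => d₁_mem_koszulDegree (hℳ := hℳ) (c := S.dplus x) (hS t x hx)) hc

lemma mem_derivedPart {E : AddSubgroup (KoszulModule n k M)} {i : ℤ}
    {w : S.derivedWall.total i} :
    w ∈ S.derivedPart E i ↔ ((w : S.splitHomology) : KoszulModule n k M) ∈ E := Iff.rfl

lemma totalDiff_mem_derivedPart (hS : IsHomogeneousSplitting S)
    (hbelow : ∃ d₀ : ℤ, ∀ d < d₀, ℳ d = ⊥) (h : S.derivedWall.LocallyFinite) {i t : ℤ}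
    {w : S.derivedWall.total (i + 1)} (hw : w ∈ S.derivedPart (koszulDegree n ℳ t) (i + 1)) :
    S.derivedWall.totalDiff h i w ∈ S.derivedPart (koszulDegree n ℳ t) i := by
  rw [mem_derivedPart, S.coe_totalDiff hbelow]
  exact P_mem_koszulDegree hS (series_mem_koszulDegree hS hbelow (d₁_mem_koszulDegree hw))

lemma derivedAugment_mem (hS : IsHomogeneousSplitting S)
    (hbelow : ∃ d₀ : ℤ, ∀ d < d₀, ℳ d = ⊥) {t : ℤ} {w : S.derivedWall.total 0}
    (hw : w ∈ S.derivedPart (koszulDegree n ℳ t) 0) : S.derivedAugment hbelow w ∈ ℳ t := by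
  rw [derivedAugment_apply, inclusion_apply]
  exact koszulAugment_mem hℳ (AddSubgroup.add_mem _ hw
    (hS t _ (series_mem_koszulDegree hS hbelow (d₁_mem_koszulDegree hw))))

variable (S)

/-- The modules of the derived Wall complex have bases of homogeneous elements. -/
lemma exists_derived_basis (i : ℤ) :
    ∃ (J : Type u) (b : Module.Basis J (MvPolynomial (Fin n) k) (S.derivedWall.total i))
      (δ : J → ℤ), IsHomogeneousSplitting S → ∀ t, S.derivedPart (koszulDegree n ℳ t) i =
        AddSubgroup.closure {x | ∃ (j : J) (a : ℕ) (f : MvPolynomial (Fin n) k),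
          f.IsHomogeneous a ∧ a + δ j = t ∧ x = f • b j} := by
  obtain ⟨s₁, p, J, deg, b, hP₁, hds, hss, hsds, hb, hbdeg, hpb, hspan⟩ :=
    exists_homology_basis hℳ
  set d : Module.End (MvPolynomial (Fin n) k) (KoszulModule n k M) := (koszulBicomplex ℳ hℳ).d
    with hd
  have hdd : d * d = 0 := (koszulBicomplex ℳ hℳ).d_d
  have h₁ : PerturbationData d 0 s₁ 1 := .of_splitting hdd hss hds hsds
  have h : PerturbationData d 0 S.dplus 1 := .of_splitting hdd S.dplus_dplus
    (by rw [mul_assoc]; exact S.d_dplus_d) (by rw [mul_assoc]; exact S.dplus_d_dplus)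
  set P₁ : Module.End (MvPolynomial (Fin n) k) (KoszulModule n k M) := 1 - d * s₁ - s₁ * d
  replace hP₁ : ∀ f c, P₁ (koszulEquiv n k M (f ⊗ₜ c)) = koszulEquiv n k M (f ⊗ₜ p c) := hP₁
  let P : Module.End (MvPolynomial (Fin n) k) (KoszulModule n k M) := S.P
  have hPPP : P * P₁ * P = P := h.proj_mul_proj_mul_proj s₁
  have hPPP₁ : P₁ * P * P₁ = P₁ := h₁.proj_mul_proj_mul_proj S.dplus
  let I := {j : J // (deg j).1 = i}
  let w : I → S.derivedWall.total i := fun j => S.projTotal i (koszulEquiv n k M (1 ⊗ₜ b j))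
  have hbI : ∀ j : I, b j ∈ exteriorPiece n ℳ (i, (deg j).2) := fun j => by
    have := hbdeg j
    rwa [show deg j = (i, (deg j).2) from Prod.ext j.2 rfl] at this
  have hw : ∀ j : I, ((w j : S.splitHomology) : KoszulModule n k M) =
      S.P (koszulEquiv n k M (1 ⊗ₜ b j)) := fun j =>
    S.coe_projTotal (koszulEquiv_mem_koszulExterior 1 (hbI j))
  -- Independence is tested after `P₁`: since `P₁ P P₁ = P₁`, it sends `w j = P (1 ⊗ b j)` back to
  -- `1 ⊗ b j`, and these are independent by flatness.
  have hli : LinearIndependent (MvPolynomial (Fin n) k) w := by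
    refine LinearIndependent.of_comp ((koszulEquiv n k M).symm.toLinearMap ∘ₗ P₁ ∘ₗ
      S.splitHomology.subtype ∘ₗ (S.derivedWall.total i).subtype) ?_
    have e : ((koszulEquiv n k M).symm.toLinearMap ∘ₗ P₁ ∘ₗ
        S.splitHomology.subtype ∘ₗ (S.derivedWall.total i).subtype) ∘ w =
        fun j : I => (1 : MvPolynomial (Fin n) k) ⊗ₜ b j := by
      funext j
      have e1 : P₁ (koszulEquiv n k M (1 ⊗ₜ b j)) = koszulEquiv n k M (1 ⊗ₜ b j) := by
        rw [hP₁, hpb]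
      have e2 := LinearMap.congr_fun hPPP₁ (koszulEquiv n k M (1 ⊗ₜ b j))
      simp only [Module.End.mul_apply, e1] at e2
      simp only [Function.comp_apply, LinearMap.comp_apply, Submodule.subtype_apply, hw]
      exact (koszulEquiv n k M).symm_apply_eq.2 e2
    rw [e]
    exact Module.Flat.linearIndependent_one_tmul (hb.comp _ Subtype.val_injective)
  have hpmem : ∀ a, ∀ x ∈ exteriorPiece n ℳ a, p x ∈ exteriorPiece n ℳ a := fun a x hx => by
    refine Submodule.span_le.2 ?_ (hspan a x hx)
    rintro _ ⟨j, rfl, rfl⟩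
    exact hbdeg j
  have hP₁single : ∀ (σ : Finset (Fin n)) (f : MvPolynomial (Fin n) k) (m : M),
      P₁ (Pi.single σ (f ⊗ₜ m)) = koszulEquiv n k M (f ⊗ₜ p (Pi.single σ m)) := fun σ f m => by
    rw [← hP₁, koszulEquiv_tmul_single]
  have hP₁mem : ∀ c ∈ koszulExterior n k M i, P₁ c ∈ koszulExterior n k M i := fun c hc =>
    koszulExterior_induction hℳ.isInternal
      (Y := (koszulExterior n k M i).toAddSubgroup.comap
        (P₁ : KoszulModule n k M →+ KoszulModule n k M))
      (fun σ hσ f e m hm => by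
        change P₁ (Pi.single σ (f ⊗ₜ m)) ∈ koszulExterior n k M i
        rw [hP₁single]
        refine koszulEquiv_mem_koszulExterior f (hpmem _ _ ?_) (e := e)
        rw [← hσ]
        exact single_mem_exteriorPiece hm) hc
  -- From `P P₁ P = P` and `P x = x`. Generation of `W_i` thus reduces to images of `P₁`, which are
  -- spanned by the `f ⊗ b j`.
  have hrep : ∀ x : S.derivedWall.total i,
      S.projTotal i (P₁ (x : S.splitHomology)) = x := fun x => by
    refine S.total_ext ?_
    rw [S.coe_projTotal (hP₁mem _ (S.total_mem x))]
    have := LinearMap.congr_fun hPPP ((x : S.splitHomology) : KoszulModule n k M)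
    simp only [Module.End.mul_apply] at this
    rw [show P ((x : S.splitHomology) : KoszulModule n k M) = (x : S.splitHomology) from
      S.P_of_mem x] at this
    exact this
  have hgen : ∀ (Y : AddSubgroup (S.derivedWall.total i)) (f : MvPolynomial (Fin n) k) (e : ℤ)
      (σ : Finset (Fin n)) (m : M), (σ.card : ℤ) = i → m ∈ ℳ e →
      (∀ (r : k) (j : I), (deg j).2 = e → (r • f) • w j ∈ Y) →
      S.projTotal i (P₁ (Pi.single σ (f ⊗ₜ m))) ∈ Y := by
    intro Y f e σ m hσ hm hY
    rw [hP₁single]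
    have h1 := hspan _ _ (single_mem_exteriorPiece (σ := σ) hm)
    generalize p (Pi.single σ m) = l at h1
    -- `Y` is only a subgroup, so the coefficients from `k` in the expansion of `l` are moved across
    -- the tensor product into the polynomial; hence the scalar `r`.
    have key : ∀ r : k, S.projTotal i (koszulEquiv n k M ((r • f) ⊗ₜ l)) ∈ Y := by
      induction h1 using Submodule.span_induction with
      | mem x hx =>
        obtain ⟨j, hj, rfl⟩ := hx
        intro r
        have hj' : deg j = (i, e) := by rw [← hσ]; exact hj
        have := hY r ⟨j, by rw [hj']⟩ (by rw [hj'])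
        rw [← map_smul, ← map_smul, TensorProduct.smul_tmul', smul_eq_mul, mul_one] at this
        exact this
      | zero => intro r; rw [TensorProduct.tmul_zero, map_zero, map_zero]; exact Y.zero_mem
      | add x y _ _ hx hy =>
        intro r
        rw [TensorProduct.tmul_add, map_add, map_add]
        exact Y.add_mem (hx r) (hy r)
      | smul a x _ hx =>
        intro r
        rw [← TensorProduct.smul_tmul, smul_smul]
        exact hx _
    simpa using key 1
  have hsp : ⊤ ≤ Submodule.span (MvPolynomial (Fin n) k) (Set.range w) := by
    intro x _
    rw [← hrep x]
    exact koszulExterior_induction hℳ.isInternal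
      (Y := (Submodule.span (MvPolynomial (Fin n) k) (Set.range w)).toAddSubgroup.comap
        (S.projTotal i ∘ₗ P₁ : KoszulModule n k M →+ S.derivedWall.total i))
      (fun σ hσ f e m hm => hgen (Submodule.span (MvPolynomial (Fin n) k)
        (Set.range w)).toAddSubgroup f e σ m hσ hm fun r j _ =>
        Submodule.smul_mem _ _ (Submodule.subset_span ⟨j, rfl⟩)) (S.total_mem x)
  -- The degree of `1 ⊗ b j` is its exterior degree `i` plus its degree in `M`. Homogeneity of the
  -- splitting enters only in the comparison of components, through `P`.
  refine ⟨I, Module.Basis.mk hli hsp, fun j => i + (deg j).2, fun hS t => le_antisymm ?_ ?_⟩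
  · intro x hx
    rw [← hrep x, ← exteriorProj_of_mem (S.total_mem x)]
    let Y : AddSubgroup (S.derivedWall.total i) := AddSubgroup.closure
      {x | ∃ (j : I) (a : ℕ) (f : MvPolynomial (Fin n) k),
        f.IsHomogeneous a ∧ a + (i + (deg j).2) = t ∧ x = f • Module.Basis.mk hli hsp j}
    refine koszulDegree_induction
      (Y := Y.comap (S.projTotal i ∘ₗ P₁ : KoszulModule n k M →+ S.derivedWall.total i))
      (fun σ hσ f a e hf ht m hm => hgen Y f e σ m hσ hm fun r j hj =>
        AddSubgroup.subset_closure ⟨j, a, r • f, ?_, ?_, ?_⟩) hx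
    · rw [MvPolynomial.smul_eq_C_mul]
      simpa using (MvPolynomial.isHomogeneous_C (Fin n) r).mul hf
    · rw [hj, ← ht]; ring
    · rw [Module.Basis.mk_apply]
  · refine (AddSubgroup.closure_le _).2 ?_
    rintro _ ⟨j, a, f, hf, rfl, rfl⟩
    rw [Module.Basis.mk_apply]
    change f • ((w j : S.splitHomology) : KoszulModule n k M) ∈ koszulDegree n ℳ _
    rw [hw, ← map_smul, ← map_smul, TensorProduct.smul_tmul', smul_eq_mul, mul_one]
    have := P_mem_koszulDegree hS (koszulEquiv_mem_koszulDegree hf (hbI j))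
    rwa [show (a : ℤ) + (i + (deg j).2) = i + a + (deg j).2 by ring]

lemma derivedWall_isMinimalFreeResolution (hbelow : ∃ d₀ : ℤ, ∀ d < d₀, ℳ d = ⊥)
    (h : S.derivedWall.IsWallComplex) :
    IsMinimalFreeResolution (F := fun i => S.derivedWall.total i)
      (S.derivedWall.totalDiff h.locallyFinite) (S.derivedAugment hbelow) where
  subsingleton _ hi := S.derivedWall_subsingleton hi
  free i := by
    obtain ⟨J, b, _⟩ := S.exists_derived_basis i
    exact Module.Free.of_basis b
  surjective := S.derivedAugment_surjective hbelow
  exact_zero := S.derivedAugment_exact hbelow h.locallyFinite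
  exact _ hi := S.derivedWall_exact hbelow h hi
  minimal := S.derivedWall_minimal hbelow h.locallyFinite

lemma derivedWall_isGradedComplex (hbelow : ∃ d₀ : ℤ, ∀ d < d₀, ℳ d = ⊥)
    (h : S.derivedWall.IsWallComplex) (hS : IsHomogeneousSplitting S) :
    IsGradedComplex (F := fun i => S.derivedWall.total i) ℳ
      (S.derivedWall.totalDiff h.locallyFinite) (S.derivedAugment hbelow)
      fun i t => S.derivedPart (koszulDegree n ℳ t) i where
  gradedFree i := by
    obtain ⟨J, b, δ, hb⟩ := S.exists_derived_basis i
    exact isGradedFree_of_basis b δ (hb hS)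
  diff_mem _ _ _ hx := totalDiff_mem_derivedPart hS hbelow h.locallyFinite hx
  ε_mem _ _ hx := derivedAugment_mem hS hbelow hx

end VerticalSplitting

end Koszul

attribute [local instance] totalAddCommGroup

/-! ## Isomorphisms of Wall arrays -/

namespace WallArray

variable {R : Type*} [Ring R] {W W' : Type*} [AddCommGroup W] [Module R W]
  [AddCommGroup W'] [Module R W']

/-- An isomorphism of Wall arrays. -/
structure Iso (A : WallArray R W) (A' : WallArray R W') where
  equiv : W ≃ₗ[R] W'
  map_deg : ∀ p q, (A.deg p q).map equiv.toLinearMap = A'.deg p q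
  map_ω : ∀ j w, equiv (A.ω j w) = A'.ω j (equiv w)

namespace Iso

variable {A : WallArray R W} {A' : WallArray R W'} (φ : Iso A A')

lemma map_total (i : ℤ) : (A.total i).map φ.equiv.toLinearMap = A'.total i := by
  simp only [total, Submodule.map_iSup, φ.map_deg]

/-- The isomorphism on the modules of the total complexes. -/
def total (i : ℤ) : A.total i ≃ₗ[R] A'.total i :=
  (φ.equiv.submoduleMap (A.total i)).trans (LinearEquiv.ofEq _ _ (φ.map_total i))

include φ in
lemma locallyFinite (h : A.LocallyFinite) : A'.LocallyFinite := by
  intro p q w hw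
  rw [← φ.map_deg] at hw
  obtain ⟨x, hx, rfl⟩ := hw
  refine (h p q x hx).subset fun j hj h0 => hj ?_
  rw [LinearEquiv.coe_coe, ← φ.map_ω, h0, map_zero]

lemma map_D (h : A.LocallyFinite) (h' : A'.LocallyFinite) (w : W) :
    φ.equiv (A.D h w) = A'.D h' (φ.equiv w) := by
  have := AddMonoidHom.map_finsum (φ.equiv : W →+ W') (h.finite w)
  refine this.trans (finsum_congr fun j => ?_)
  exact φ.map_ω j w

include φ in
lemma isWallComplex (h : A.IsWallComplex) : A'.IsWallComplex where
  locallyFinite := φ.locallyFinite h.locallyFinite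
  D_sq := by
    refine LinearMap.ext fun w => ?_
    obtain ⟨x, rfl⟩ := φ.equiv.surjective w
    rw [LinearMap.comp_apply, ← φ.map_D h.locallyFinite, ← φ.map_D h.locallyFinite]
    have := LinearMap.congr_fun h.D_sq x
    rw [LinearMap.comp_apply] at this
    rw [this]
    simp

lemma total_totalDiff (h : A.LocallyFinite) (h' : A'.LocallyFinite) {i : ℤ}
    (w : A.total (i + 1)) :
    φ.total i (A.totalDiff h i w) = A'.totalDiff h' i (φ.total (i + 1) w) :=
  Subtype.ext (φ.map_D h h' w)

end Iso

end WallArray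

/-! ## Transport of minimal free resolutions -/

section Transport

variable {k : Type*} [Field k] {n : ℕ} {F F' : ℤ → Type*} [∀ i, AddCommGroup (F i)]
  [∀ i, Module (MvPolynomial (Fin n) k) (F i)] [∀ i, AddCommGroup (F' i)]
  [∀ i, Module (MvPolynomial (Fin n) k) (F' i)] {M : Type*} [AddCommGroup M]
  [Module (MvPolynomial (Fin n) k) M]
  {diff : ∀ i, F (i + 1) →ₗ[MvPolynomial (Fin n) k] F i}
  {diff' : ∀ i, F' (i + 1) →ₗ[MvPolynomial (Fin n) k] F' i}
  {ε : F 0 →ₗ[MvPolynomial (Fin n) k] M}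

lemma IsMinimalFreeResolution.congr (h : IsMinimalFreeResolution diff ε)
    (φ : ∀ i, F i ≃ₗ[MvPolynomial (Fin n) k] F' i)
    (hφ : ∀ i x, φ i (diff i x) = diff' i (φ (i + 1) x)) :
    IsMinimalFreeResolution diff' (ε ∘ₗ (φ 0).symm.toLinearMap) where
  subsingleton i hi := by
    have := h.subsingleton i hi
    exact (φ i).symm.injective.subsingleton
  free i := by
    have := h.free i
    exact Module.Free.of_equiv (φ i)
  surjective := h.surjective.comp (φ 0).symm.surjective
  exact_zero := by
    intro y
    obtain ⟨y, rfl⟩ := (φ 0).surjective y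
    rw [LinearMap.comp_apply, LinearEquiv.coe_coe, LinearEquiv.symm_apply_apply,
      h.exact_zero y]
    constructor
    · rintro ⟨x, rfl⟩
      exact ⟨φ (0 + 1) x, (hφ 0 x).symm⟩
    · rintro ⟨x, hx⟩
      obtain ⟨x, rfl⟩ := (φ (0 + 1)).surjective x
      exact ⟨x, (φ 0).injective ((hφ 0 x).trans hx)⟩
  exact i hi := by
    intro y
    obtain ⟨y, rfl⟩ := (φ (i + 1)).surjective y
    rw [← hφ, LinearEquiv.map_eq_zero_iff, h.exact i hi y]
    constructor
    · rintro ⟨x, rfl⟩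
      exact ⟨φ (i + 1 + 1) x, (hφ (i + 1) x).symm⟩
    · rintro ⟨x, hx⟩
      obtain ⟨x, rfl⟩ := (φ (i + 1 + 1)).surjective x
      exact ⟨x, (φ (i + 1)).injective ((hφ (i + 1) x).trans hx)⟩
  minimal i y := by
    obtain ⟨y, rfl⟩ := (φ (i + 1)).surjective y
    rw [← hφ]
    have := Submodule.mem_map_of_mem (f := (φ i).toLinearMap) (h.minimal i y)
    rw [Submodule.map_smul''] at this
    exact Submodule.smul_mono le_rfl le_top this

lemma IsGradedFree.congr {F F' : Type*} [AddCommGroup F] [Module (MvPolynomial (Fin n) k) F]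
    [AddCommGroup F'] [Module (MvPolynomial (Fin n) k) F'] {G : ℤ → AddSubgroup F}
    {G' : ℤ → AddSubgroup F'} (h : IsGradedFree (k := k) (n := n) G)
    (φ : F ≃ₗ[MvPolynomial (Fin n) k] F') (hG : ∀ t, G' t = (G t).map (φ : F →+ F')) :
    IsGradedFree (k := k) (n := n) G' := by
  obtain ⟨I, b, δ, hb⟩ := h
  refine isGradedFree_of_basis (b.map φ) δ fun t => ?_
  rw [hG, hb, AddMonoidHom.map_closure]
  congr 1
  ext x
  constructor
  · rintro ⟨_, ⟨j, a, f, hf, ht, rfl⟩, rfl⟩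
    exact ⟨j, a, f, hf, ht, map_smul φ f (b j)⟩
  · rintro ⟨j, a, f, hf, ht, rfl⟩
    exact ⟨f • b j, ⟨j, a, f, hf, ht, rfl⟩, map_smul φ f (b j)⟩

lemma IsGradedComplex.congr [Module k M] {ℳ : ℤ → Submodule k M}
    {G : ∀ i, ℤ → AddSubgroup (F i)} {G' : ∀ i, ℤ → AddSubgroup (F' i)}
    (h : IsGradedComplex ℳ diff ε G)
    (φ : ∀ i, F i ≃ₗ[MvPolynomial (Fin n) k] F' i)
    (hφ : ∀ i x, φ i (diff i x) = diff' i (φ (i + 1) x))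
    (hG : ∀ i t, G' i t = (G i t).map (φ i : F i →+ F' i)) :
    IsGradedComplex ℳ diff' (ε ∘ₗ (φ 0).symm.toLinearMap) G' where
  gradedFree i := (h.gradedFree i).congr (φ i) (hG i)
  diff_mem i t x hx := by
    rw [hG] at hx ⊢
    obtain ⟨x, hx, rfl⟩ := hx
    exact ⟨diff i x, h.diff_mem i t x hx, hφ i x⟩
  ε_mem t x hx := by
    rw [hG] at hx
    obtain ⟨x, hx, rfl⟩ := hx
    change ε ((φ 0).symm (φ 0 x)) ∈ ℳ t
    rw [LinearEquiv.symm_apply_apply]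
    exact h.ε_mem t x hx

end Transport

/-! ## The natural Wall complex -/

namespace VerticalSplitting

section

variable {R : Type*} [Ring R] {C : Type*} [AddCommGroup C] [Module R C]
  {B : Bicomplex R C} (S : VerticalSplitting B)

lemma splitHomology_d (w : S.splitHomology) : B.d (w : C) = 0 := by
  rw [← S.P_of_mem w, S.d_P]

lemma splitHomology_dplus (w : S.splitHomology) : S.dplus (w : C) = 0 := by
  rw [← S.P_of_mem w]
  simp only [P_apply, map_sub, S.sds, S.ss]
  simp

/-- The class of an element of the split homology in the natural homology. -/
def toNatural : S.splitHomology →ₗ[R] B.naturalHomology :=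
  B.boundaries.mkQ ∘ₗ S.splitHomology.subtype.codRestrict (LinearMap.ker B.d) S.splitHomology_d

lemma toNatural_apply (w : S.splitHomology) :
    S.toNatural w = B.boundaries.mkQ ⟨w, S.splitHomology_d w⟩ := rfl

/-- On a cycle, `P z - z = -d d⁺ z` is a boundary. -/
lemma toNatural_P (z : LinearMap.ker B.d) :
    S.toNatural (S.P.rangeRestrict z) = B.boundaries.mkQ z := by
  rw [toNatural_apply, ← sub_eq_zero, ← map_sub, Submodule.mkQ_apply,
    Submodule.Quotient.mk_eq_zero]
  refine ⟨-S.dplus z, ?_⟩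
  have hz : B.d (z : C) = 0 := z.2
  change B.d (-S.dplus z) = S.P z - z
  rw [P_apply, hz, map_zero, map_neg]
  abel

lemma toNatural_bijective : Function.Bijective S.toNatural := by
  constructor
  · rw [← LinearMap.ker_eq_bot, LinearMap.ker_eq_bot']
    intro w hw
    rw [toNatural_apply, Submodule.mkQ_apply, Submodule.Quotient.mk_eq_zero] at hw
    obtain ⟨y, hy⟩ := hw
    have hy' : B.d y = w := hy
    refine Subtype.ext ?_
    rw [← S.P_of_mem w, ← hy', S.P_d]
    rfl
  · intro z
    obtain ⟨z, rfl⟩ := B.boundaries.mkQ_surjective z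
    exact ⟨_, S.toNatural_P z⟩

/-- The derived and the natural Wall complex are isomorphic. -/
def derivedIsoNatural : WallArray.Iso S.derivedWall S.naturalWall where
  equiv := LinearEquiv.ofBijective S.toNatural S.toNatural_bijective
  map_deg p q := by
    ext x
    constructor
    · rintro ⟨w, hw, rfl⟩
      exact ⟨⟨w, S.splitHomology_d w⟩, hw, rfl⟩
    · rintro ⟨z, hz, rfl⟩
      exact ⟨S.P.rangeRestrict z, S.P_mem hz, S.toNatural_P z⟩
  map_ω j w := by
    cases j with
    | zero => exact map_zero _
    | succ j =>
      -- The factor `1 - d d⁺` is the identity on the split homology, where `d⁺` vanishes.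
      have h1 : S.naturalOmegaCycles j ⟨w, S.splitHomology_d w⟩ = S.toCycles (S.zigzag j w) := by
        change S.toCycles (S.zigzag j (w - B.d (S.dplus w))) = _
        rw [splitHomology_dplus, map_zero, sub_zero]
      -- The factor `1 - d⁺ d` is absorbed by `P`, because `P d⁺ = 0`.
      have h2 : S.P (S.zigzag j w) = S.P (S.toCycles (S.zigzag j w)) := by
        have : S.P (S.dplus (B.d (S.zigzag j w))) = 0 := by
          simp only [P_apply, S.sds, S.ss, map_zero]
          simp
        rw [coe_toCycles, map_sub, this, sub_zero]
      have h3 : S.derivedWall.ω (j + 1) w =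
          S.P.rangeRestrict (S.toCycles (S.zigzag j w)) := Subtype.ext h2
      change S.toNatural _ = B.boundaries.mkQ (S.naturalOmegaCycles j ⟨w, S.splitHomology_d w⟩)
      rw [h3, toNatural_P, h1]

/-- A class with a representative in `E` has its unique representative in the split homology, namely
`P` of the given one, again in `E`. -/
lemma naturalPart_eq_map {E : AddSubgroup C} (hE : ∀ c ∈ E, S.P c ∈ E) (i : ℤ) :
    S.naturalPart E i = (S.derivedPart E i).map
      (S.derivedIsoNatural.total i : S.derivedWall.total i →+ S.naturalWall.total i) := by
  ext x
  constructor
  · intro hx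
    obtain ⟨w, rfl⟩ := (S.derivedIsoNatural.total i).surjective x
    refine ⟨w, ?_, rfl⟩
    obtain ⟨z, hz, hzw⟩ := hx
    have h1 : S.toNatural (S.P.rangeRestrict z) = S.toNatural w := (S.toNatural_P z).trans hzw
    have h2 := congrArg Subtype.val (S.toNatural_bijective.1 h1)
    change ((w : S.splitHomology) : C) ∈ E
    rw [← h2]
    exact hE z hz
  · rintro ⟨w, hw, rfl⟩
    exact ⟨⟨(w : S.splitHomology), S.splitHomology_d w⟩, hw, rfl⟩

end

end VerticalSplitting

end WallComplex

end

/-! ### The minimal free resolutions given by both Wall complexes -/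

theorem corollary6p8 {k : Type*} [Field k] (n : ℕ) {M : Type*} [AddCommGroup M] [Module k M]
    [Module (MvPolynomial (Fin n) k) M] [IsScalarTower k (MvPolynomial (Fin n) k) M]
    (ℳ : ℤ → Submodule k M) (hℳ : WallComplex.IsStandardGrading n ℳ)
    (hbelow : ∃ d₀ : ℤ, ∀ d < d₀, ℳ d = ⊥)
    (S : WallComplex.VerticalSplitting (WallComplex.koszulBicomplex ℳ hℳ)) :
    (∃ (h : S.derivedWall.IsWallComplex)
      (ε : S.derivedWall.total 0 →ₗ[MvPolynomial (Fin n) k] M),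
      WallComplex.IsMinimalFreeResolution (F := fun i => S.derivedWall.total i)
        (S.derivedWall.totalDiff h.locallyFinite) ε ∧
      (WallComplex.IsHomogeneousSplitting S →
        WallComplex.IsGradedComplex (F := fun i => S.derivedWall.total i) ℳ
          (S.derivedWall.totalDiff h.locallyFinite) ε
          fun i t => S.derivedPart (WallComplex.koszulDegree n ℳ t) i)) ∧
    (∃ (h : S.naturalWall.IsWallComplex)
      (ε : S.naturalWall.total 0 →ₗ[MvPolynomial (Fin n) k] M),
      WallComplex.IsMinimalFreeResolution (F := fun i => S.naturalWall.total i)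
        (S.naturalWall.totalDiff h.locallyFinite) ε ∧
      (WallComplex.IsHomogeneousSplitting S →
        WallComplex.IsGradedComplex (F := fun i => S.naturalWall.total i) ℳ
          (S.naturalWall.totalDiff h.locallyFinite) ε
          fun i t => S.naturalPart (WallComplex.koszulDegree n ℳ t) i)) := by
  have h := S.derivedWall_isWallComplex hbelow
  have hres := S.derivedWall_isMinimalFreeResolution hbelow h
  have hgr := S.derivedWall_isGradedComplex hbelow h
  let φ := S.derivedIsoNatural
  have h' := φ.isWallComplex h
  have hφ : ∀ i x, φ.total i (S.derivedWall.totalDiff h.locallyFinite i x) =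
      S.naturalWall.totalDiff h'.locallyFinite i (φ.total (i + 1) x) := fun i x =>
    φ.total_totalDiff h.locallyFinite h'.locallyFinite x
  exact ⟨⟨h, _, hres, hgr⟩, ⟨h', _, hres.congr φ.total hφ, fun hS =>
    (hgr hS).congr φ.total hφ fun i t => S.naturalPart_eq_map
      (fun _ hc => WallComplex.VerticalSplitting.P_mem_koszulDegree hS hc) i⟩⟩
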